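/- **Setting.** Let $(M_1,g_1)$, $(M_2,g_2)$ be Riemannian manifolds of dimensions $n_1,n_2$, let $n=n_1+n_2$, and let $\rho_i$ be a positive smooth function on $M_i$. Let $M={M_1}_{\rho_2}\!\times_{\rho_1}M_2$ be the doubly warped product, i.e. $M_1\times M_2$ with the metric $g=(\rho_2\circ\pi_2)^2\pi_1^*g_1+(\rho_1\circ\pi_1)^2\pi_2^*g_2$. Let $(\tilde M,\phi,\xi,\eta,\langle\,,\rangle)$ be a $(2m+1)$-dimensional contact metric manifold, i.e. an almost contact metric manifold with $d\eta(X,Y)=\langle X,\phi Y\rangle$, where $d\eta(X,Y)=\frac12\big(X\eta(Y)-Y\eta(X)-\eta([X,Y])\big)$, and let $h=\frac12\mathcal L_\xi\phi$. Suppose that $\tilde M$ is a generalized $(\kappa,\mu)$-space form with divided $R_5$: there are functions $f_1,f_2,f_3,f_4,f_{5,1},f_{5,2},f_6$ on $\tilde M$ such that the curvature tensor $\tilde R(X,Y)Z=\tilde\nabla_X\tilde\nabla_YZ-\tilde\nabla_Y\tilde\nabla_XZ-\tilde\nabla_{[X,Y]}Z$ is $$\tilde R=f_1R_1+f_2R_2+f_3R_3+f_4R_4+f_{5,1}R_{5,1}+f_{5,2}R_{5,2}+f_6R_6,$$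 where $$\begin{aligned} R_1(X,Y)Z&=\langle Y,Z\rangle X-\langle X,Z\rangle Y,\\ R_2(X,Y)Z&=\langle X,\phi Z\rangle\phi Y-\langle Y,\phi Z\rangle\phi X+2\langle X,\phi Y\rangle\phi Z,\\ R_3(X,Y)Z&=\eta(X)\eta(Z)Y-\eta(Y)\eta(Z)X+\langle X,Z\rangle\eta(Y)\xi-\langle Y,Z\rangle\eta(X)\xi,\\ R_4(X,Y)Z&=\langle Y,Z\rangle hX-\langle X,Z\rangle hY+\langle hY,Z\rangle X-\langle hX,Z\rangle Y,\\ R_{5,1}(X,Y)Z&=\langle hY,Z\rangle hX-\langle hX,Z\rangle hY,\\ R_{5,2}(X,Y)Z&=\langle\phi hY,Z\rangle\phi hX-\langle\phi hX,Z\rangle\phi hY,\\ R_6(X,Y)Z&=\eta(X)\eta(Z)hY-\eta(Y)\eta(Z)hX+\langle hX,Z\rangle\eta(Y)\xi-\langle hY,Z\rangle\eta(X)\xi. \end{aligned}$$ Let $\mathbf x:M\to\tilde M$ be a smooth isometric immersion that is $C$-totally real, i.e. $\eta$ vanishes on the tangent vectors of $M$. Let $\sigma$ be its second fundamental form, $H=\frac1n\operatorname{tr}\sigma$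 its mean curvature vector, $A_\xi$ the operator with $\langle A_\xi X,Y\rangle=\langle\sigma(X,Y),\xi\rangle$, and $h^TX$ the tangential part of $hX$ for $X$ tangent to $M$. For a symmetric operator $T$ on $T_pM$, let $T_{|M_i}$ be the operator on $T_pM_i$ (the vectors at $p$ tangent to the leaf of $M_i$ through $p$) given by $\langle T_{|M_i}X,Y\rangle=\langle TX,Y\rangle$ for $X,Y\in T_pM_i$, and let $\|T\|^2$ be the sum of the squares of its matrix entries in an orthonormal basis. Let $H_i=\frac1{n_i}\operatorname{tr}(\sigma_{|T_pM_i})$ be the partial mean curvature vectors. Let $\Delta_i\psi=-\operatorname{tr}(\operatorname{Hess}\psi)$ be the Laplacian of the leaf of $M_i$ through the point considered, with the metric induced from $M$ (that is, $\rho_2^2g_1$ with $\rho_2$ constant on the leaf for $i=1$, and $\rho_1^2g_2$ with $\rho_1$ constant on the leaf for $i=2$). **Theorem.** At every point of $M$, $$\begin{aligned} n_2\frac{\Delta_1\rho_1}{\rho_1}+n_1\frac{\Delta_2\rho_2}{\rho_2}\le{}&\frac{n^2}{4}\|H\|^2+n_1n_2f_1+f_4\Big(n_2\operatorname{tr}(h^T_{|M_1})+n_1\operatorname{tr}(h^T_{|M_2})\Big)\\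 &+\tfrac12f_{5,1}\Big((\operatorname{tr}h^T)^2-(\operatorname{tr}h^T_{|M_1})^2-(\operatorname{tr}h^T_{|M_2})^2-\|h^T\|^2+\|h^T_{|M_1}\|^2+\|h^T_{|M_2}\|^2\Big)\\ &+\tfrac12f_{5,2}\Big((\operatorname{tr}A_\xi)^2-(\operatorname{tr}A_{\xi|M_1})^2-(\operatorname{tr}A_{\xi|M_2})^2-\|A_\xi\|^2+\|A_{\xi|M_1}\|^2+\|A_{\xi|M_2}\|^2\Big). \end{aligned}$$ Equality holds identically (at every point of $M$) if and only if $M$ is mixed totally geodesic, i.e. $\sigma(X,Z)=0$ for all $X$ tangent to $M_1$ and $Z$ tangent to $M_2$, and $n_1H_1=n_2H_2$ everywhere. -/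

import Mathlib

open Bundle Manifold ContDiff

noncomputable section

section Coordinates

/-! Riemannian geometry of a metric `G` on an open part of a finite-dimensional vector space `E`. -/

variable {E : Type*} [NormedAddCommGroup E] [NormedSpace ℝ E]

/-- The Christoffel map `Γ_y(u, v) = ∇_u v` (for constant vector fields `u`, `v`), characterised by
`2 G(Γ(u, v), z) = (D_u G)(v, z) + (D_v G)(u, z) - (D_z G)(u, v)`. -/
def christoffel (G : E → E →L[ℝ] E →L[ℝ] ℝ) (y u v : E) : E :=
  (G y).inverse ((1 / 2 : ℝ) •
    (fderiv ℝ G y u v + fderiv ℝ G y v u - ((fderiv ℝ G y).flip u).flip v))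

/-- `R(u, v) w = ∇_u ∇_v w - ∇_v ∇_u w - ∇_[u, v] w` for constant vector fields `u`, `v`, `w`. -/
def coordCurvature (G : E → E →L[ℝ] E →L[ℝ] ℝ) (y u v w : E) : E :=
  fderiv ℝ (fun z => christoffel G z v w) y u - fderiv ℝ (fun z => christoffel G z u w) y v
    + christoffel G y u (christoffel G y v w) - christoffel G y v (christoffel G y u w)

variable [FiniteDimensional ℝ E]

/-- The metric trace `∑ b^{ij} B(e_i, e_j)` of a bilinear map `B` with respect to an inner
product `b`, where `(b^{ij})` is the inverse of the Gram matrix of the basis `e`. For a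
`b`-orthonormal basis this is `∑ B(e_i, e_i)`; it does not depend on the basis. -/
def metricTrace {W : Type*} [AddCommGroup W] [Module ℝ W]
    (b : E →L[ℝ] E →L[ℝ] ℝ) (B : E → E → W) : W :=
  ∑ i, ∑ j, (Matrix.of fun k l => b (Module.finBasis ℝ E k) (Module.finBasis ℝ E l))⁻¹ i j •
    B (Module.finBasis ℝ E i) (Module.finBasis ℝ E j)

/-- The squared norm `∑ b^{ij} b^{kl} B(e_i, e_k) B(e_j, e_l)` of a bilinear form `B`, which is
`∑ B(e_i, e_j)²` in a `b`-orthonormal basis. If `B(u, v) = b(T u, v)`, it is `‖T‖²`. -/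
def metricNormSq (b : E →L[ℝ] E →L[ℝ] ℝ) (B : E → E → ℝ) : ℝ :=
  metricTrace b fun u v => metricTrace b fun w z => B u w * B v z

end Coordinates

section Manifolds

/-! Manifolds without boundary. The tangent space at `p` is the model space `E`, the
identification being the one by the preferred chart at `p`. A metric is given by its
values on the tangent spaces. -/

variable {E : Type*} [NormedAddCommGroup E] [NormedSpace ℝ E]
  {H : Type*} [TopologicalSpace H] (I : ModelWithCorners ℝ E H)
  {M : Type*} [TopologicalSpace M] [ChartedSpace H M]

/-- The differential at `y` of the inverse of the preferred chart at `p`. -/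
def chartSymmDeriv (p : M) (y : E) : E →L[ℝ] TangentSpace I ((extChartAt I p).symm y) :=
  mfderiv 𝓘(ℝ, E) I (extChartAt I p).symm y

/-- The differential of the preferred chart at `p`, at the point with coordinates `y`. -/
def chartDeriv (p : M) (y : E) : TangentSpace I ((extChartAt I p).symm y) →L[ℝ] E :=
  mfderiv I 𝓘(ℝ, E) (extChartAt I p) ((extChartAt I p).symm y)

/-- A metric in the coordinates of the preferred chart at `p`. -/
def metricInChart (g : ∀ x : M, TangentSpace I x →L[ℝ] TangentSpace I x →L[ℝ] ℝ) (p : M) (y : E) :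
    E →L[ℝ] E →L[ℝ] ℝ :=
  letI G : E →L[ℝ] E →L[ℝ] ℝ := g ((extChartAt I p).symm y)
  letI T : E →L[ℝ] E := chartSymmDeriv I p y
  G.bilinearComp T T

/-- The curvature tensor `R(u, v) w` of the Levi-Civita connection of `g` at `p`. -/
def curvatureTensor (g : ∀ x : M, TangentSpace I x →L[ℝ] TangentSpace I x →L[ℝ] ℝ) (p : M)
    (u v w : TangentSpace I p) : TangentSpace I p :=
  coordCurvature (E := E) (metricInChart I g p) (extChartAt I p p) u v w

/-- The Hessian `H^ψ(u, v) = u v ψ - (∇_u v) ψ` at `p`. -/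
def hessian (g : ∀ x : M, TangentSpace I x →L[ℝ] TangentSpace I x →L[ℝ] ℝ) (ψ : M → ℝ) (p : M)
    (u v : E) : ℝ :=
  fderiv ℝ (fderiv ℝ (ψ ∘ (extChartAt I p).symm)) (extChartAt I p p) u v
    - fderiv ℝ (ψ ∘ (extChartAt I p).symm) (extChartAt I p p)
        (christoffel (metricInChart I g p) (extChartAt I p p) u v)

/-- The Laplacian with the sign convention `Δ ψ = - trace H^ψ`. -/
def laplacian [FiniteDimensional ℝ E]
    (g : ∀ x : M, TangentSpace I x →L[ℝ] TangentSpace I x →L[ℝ] ℝ) (ψ : M → ℝ) (p : M) : ℝ :=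
  - metricTrace (E := E) (g p) (hessian I g ψ p)

variable {E' : Type*} [NormedAddCommGroup E'] [NormedSpace ℝ E']
  {H' : Type*} [TopologicalSpace H'] (I' : ModelWithCorners ℝ E' H')
  {N : Type*} [TopologicalSpace N] [ChartedSpace H' N]

/-- The second fundamental form of a map `f` from `(M, g)` to `(N, g')`, by the Gauss formula
`σ(u, v) = ∇'_u (df v) - df (∇_u v)` for vector fields `u`, `v` constant in the chart at `p`. -/
def secondFundamentalForm (g : ∀ x : M, TangentSpace I x →L[ℝ] TangentSpace I x →L[ℝ] ℝ)
    (g' : ∀ x : N, TangentSpace I' x →L[ℝ] TangentSpace I' x →L[ℝ] ℝ) (f : M → N) (p : M)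
    (u v : E) : E' :=
  letI df : E →L[ℝ] E' := mfderiv I I' f p
  fderiv ℝ (fderiv ℝ (writtenInExtChartAt I I' p f)) (extChartAt I p p) u v
    + christoffel (metricInChart I' g' (f p)) (extChartAt I' (f p) (f p)) (df u) (df v)
    - df (christoffel (metricInChart I g p) (extChartAt I p p) u v)

end Manifolds

section DoublyWarped

variable {E₁ : Type*} [NormedAddCommGroup E₁] [NormedSpace ℝ E₁]
  {H₁ : Type*} [TopologicalSpace H₁] (I₁ : ModelWithCorners ℝ E₁ H₁)
  {M₁ : Type*} [TopologicalSpace M₁] [ChartedSpace H₁ M₁]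
  {E₂ : Type*} [NormedAddCommGroup E₂] [NormedSpace ℝ E₂]
  {H₂ : Type*} [TopologicalSpace H₂] (I₂ : ModelWithCorners ℝ E₂ H₂)
  {M₂ : Type*} [TopologicalSpace M₂] [ChartedSpace H₂ M₂]

/-- The metric induced on the leaf `M₁ × {q}` by the doubly warped product metric. -/
def leafMetric₁ (g₁ : ∀ x : M₁, TangentSpace I₁ x →L[ℝ] TangentSpace I₁ x →L[ℝ] ℝ)
    (ρ₂ : M₂ → ℝ) (q : M₂) (x : M₁) : TangentSpace I₁ x →L[ℝ] TangentSpace I₁ x →L[ℝ] ℝ :=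
  (ρ₂ q) ^ 2 • g₁ x

/-- The metric induced on the leaf `{q} × M₂` by the doubly warped product metric. -/
def leafMetric₂ (g₂ : ∀ x : M₂, TangentSpace I₂ x →L[ℝ] TangentSpace I₂ x →L[ℝ] ℝ)
    (ρ₁ : M₁ → ℝ) (q : M₁) (x : M₂) : TangentSpace I₂ x →L[ℝ] TangentSpace I₂ x →L[ℝ] ℝ :=
  (ρ₁ q) ^ 2 • g₂ x

/-- The metric `(ρ₂ ∘ π₂)² π₁^* g₁ + (ρ₁ ∘ π₁)² π₂^* g₂` on `M₁ × M₂`. -/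
def doublyWarpedMetric (g₁ : ∀ x : M₁, TangentSpace I₁ x →L[ℝ] TangentSpace I₁ x →L[ℝ] ℝ)
    (g₂ : ∀ x : M₂, TangentSpace I₂ x →L[ℝ] TangentSpace I₂ x →L[ℝ] ℝ)
    (ρ₁ : M₁ → ℝ) (ρ₂ : M₂ → ℝ) (p : M₁ × M₂) :
    TangentSpace (I₁.prod I₂) p →L[ℝ] TangentSpace (I₁.prod I₂) p →L[ℝ] ℝ :=
  letI G₁ : E₁ →L[ℝ] E₁ →L[ℝ] ℝ := g₁ p.1
  letI G₂ : E₂ →L[ℝ] E₂ →L[ℝ] ℝ := g₂ p.2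
  letI dπ₁ : E₁ × E₂ →L[ℝ] E₁ := mfderiv (I₁.prod I₂) I₁ (Prod.fst : M₁ × M₂ → M₁) p
  letI dπ₂ : E₁ × E₂ →L[ℝ] E₂ := mfderiv (I₁.prod I₂) I₂ (Prod.snd : M₁ × M₂ → M₂) p
  ((ρ₂ p.2) ^ 2 • G₁.bilinearComp dπ₁ dπ₁ + (ρ₁ p.1) ^ 2 • G₂.bilinearComp dπ₂ dπ₂ :
    E₁ × E₂ →L[ℝ] E₁ × E₂ →L[ℝ] ℝ)

/-- The restriction of a bilinear map on `T_p(M₁ × M₂)` to the vectors tangent to `M₁`. -/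
def restrict₁ {W : Type*} (B : E₁ × E₂ → E₁ × E₂ → W) (u v : E₁) : W := B (u, 0) (v, 0)

/-- The restriction of a bilinear map on `T_p(M₁ × M₂)` to the vectors tangent to `M₂`. -/
def restrict₂ {W : Type*} (B : E₁ × E₂ → E₁ × E₂ → W) (u v : E₂) : W := B (0, u) (0, v)

end DoublyWarped

section Contact

variable {E : Type*} [NormedAddCommGroup E] [NormedSpace ℝ E]
  {H : Type*} [TopologicalSpace H] (I : ModelWithCorners ℝ E H)
  (M : Type*) [TopologicalSpace M] [ChartedSpace H M] [IsManifold I ∞ M]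

/-- A smooth almost contact metric structure `(φ, ξ, η, g)`. -/
structure AlmostContactMetricStructure where
  g : ContMDiffRiemannianMetric I ∞ E (fun x : M => TangentSpace I x)
  φ : ∀ x : M, TangentSpace I x →L[ℝ] TangentSpace I x
  ξ : ∀ x : M, TangentSpace I x
  η : ∀ x : M, TangentSpace I x →L[ℝ] ℝ
  contMDiff_φ : ContMDiff I (I.prod 𝓘(ℝ, E →L[ℝ] E)) ∞
    (fun x => TotalSpace.mk' (E →L[ℝ] E)
      (E := fun x : M => TangentSpace I x →L[ℝ] TangentSpace I x) x (φ x))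
  contMDiff_ξ : ContMDiff I (I.prod 𝓘(ℝ, E)) ∞
    (fun x => TotalSpace.mk' E (E := fun x : M => TangentSpace I x) x (ξ x))
  contMDiff_η : ContMDiff I (I.prod 𝓘(ℝ, E →L[ℝ] ℝ)) ∞
    (fun x => TotalSpace.mk' (E →L[ℝ] ℝ)
      (E := fun x : M => TangentSpace I x →L[ℝ] Trivial M ℝ x) x (η x))
  φ_φ : ∀ x X, φ x (φ x X) = -X + η x X • ξ x
  η_ξ : ∀ x, η x (ξ x) = 1
  φ_ξ : ∀ x, φ x (ξ x) = 0
  η_φ : ∀ x X, η x (φ x X) = 0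
  g_eq : ∀ x X Y, g.inner x X Y = g.inner x (φ x X) (φ x Y) + η x X * η x Y
  g_φ : ∀ x X Y, g.inner x X (φ x Y) = - g.inner x (φ x X) Y
  g_ξ : ∀ x X, g.inner x X (ξ x) = η x X

namespace AlmostContactMetricStructure

variable {I M}
variable (S : AlmostContactMetricStructure I M)

/-- `ξ` in the coordinates of the preferred chart at `p`. -/
def ξInChart (p : M) (y : E) : E := chartDeriv I p y (S.ξ ((extChartAt I p).symm y))

/-- `η` in the coordinates of the preferred chart at `p`. -/
def ηInChart (p : M) (y : E) : E →L[ℝ] ℝ :=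
  (S.η ((extChartAt I p).symm y)).comp (chartSymmDeriv I p y)

/-- `φ` in the coordinates of the preferred chart at `p`. -/
def φInChart (p : M) (y : E) : E →L[ℝ] E :=
  (chartDeriv I p y).comp ((S.φ ((extChartAt I p).symm y)).comp (chartSymmDeriv I p y))

/-- The exterior derivative `dη(X, Y) = ½ (X η(Y) - Y η(X) - η([X, Y]))`. -/
def dη (p : M) (X Y : TangentSpace I p) : ℝ :=
  (1 / 2 : ℝ) * (fderiv ℝ (S.ηInChart p) (extChartAt I p p) (X : E) (Y : E)
    - fderiv ℝ (S.ηInChart p) (extChartAt I p p) (Y : E) (X : E))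

/-- The structure is a contact metric structure: `dη(X, Y) = g(X, φ Y)`. -/
def IsContactMetric : Prop :=
  ∀ (p : M) (X Y : TangentSpace I p), S.dη p X Y = S.g.inner p X (S.φ p Y)

/-- The tensor field `h = ½ L_ξ φ`, where `(L_ξ φ) X = [ξ, φ X] - φ [ξ, X]`; for `X` constant in
the chart this is `(D_ξ φ) X - D_{φ X} ξ + φ (D_X ξ)`. -/
def h (p : M) (X : TangentSpace I p) : TangentSpace I p :=
  letI y : E := extChartAt I p p
  letI X' : E := X
  ((1 / 2 : ℝ) • (fderiv ℝ (S.φInChart p) y (S.ξInChart p y) X'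
    - fderiv ℝ (S.ξInChart p) y (S.φInChart p y X')
    + S.φInChart p y (fderiv ℝ (S.ξInChart p) y X')) : E)

/-- `R₁(X, Y) Z`. -/
def R₁ (p : M) (X Y Z : TangentSpace I p) : TangentSpace I p :=
  S.g.inner p Y Z • X - S.g.inner p X Z • Y

/-- `R₂(X, Y) Z`. -/
def R₂ (p : M) (X Y Z : TangentSpace I p) : TangentSpace I p :=
  S.g.inner p X (S.φ p Z) • S.φ p Y - S.g.inner p Y (S.φ p Z) • S.φ p X
    + (2 * S.g.inner p X (S.φ p Y)) • S.φ p Z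

/-- `R₃(X, Y) Z`. -/
def R₃ (p : M) (X Y Z : TangentSpace I p) : TangentSpace I p :=
  (S.η p X * S.η p Z) • Y - (S.η p Y * S.η p Z) • X
    + (S.g.inner p X Z * S.η p Y) • S.ξ p - (S.g.inner p Y Z * S.η p X) • S.ξ p

/-- `R₄(X, Y) Z`. -/
def R₄ (p : M) (X Y Z : TangentSpace I p) : TangentSpace I p :=
  S.g.inner p Y Z • S.h p X - S.g.inner p X Z • S.h p Y
    + S.g.inner p (S.h p Y) Z • X - S.g.inner p (S.h p X) Z • Y

/-- `R_{5,1}(X, Y) Z`. -/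
def R₅₁ (p : M) (X Y Z : TangentSpace I p) : TangentSpace I p :=
  S.g.inner p (S.h p Y) Z • S.h p X - S.g.inner p (S.h p X) Z • S.h p Y

/-- `R_{5,2}(X, Y) Z`. -/
def R₅₂ (p : M) (X Y Z : TangentSpace I p) : TangentSpace I p :=
  S.g.inner p (S.φ p (S.h p Y)) Z • S.φ p (S.h p X)
    - S.g.inner p (S.φ p (S.h p X)) Z • S.φ p (S.h p Y)

/-- `R₆(X, Y) Z`. -/
def R₆ (p : M) (X Y Z : TangentSpace I p) : TangentSpace I p :=
  (S.η p X * S.η p Z) • S.h p Y - (S.η p Y * S.η p Z) • S.h p X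
    + (S.g.inner p (S.h p X) Z * S.η p Y) • S.ξ p - (S.g.inner p (S.h p Y) Z * S.η p X) • S.ξ p

/-- The structure is a generalized `(κ, μ)`-space form with divided `R₅`, with the functions
`f₁, f₂, f₃, f₄, f₅₁, f₅₂, f₆`. -/
def IsGeneralizedKappaMuSpaceForm (f₁ f₂ f₃ f₄ f₅₁ f₅₂ f₆ : M → ℝ) : Prop :=
  ∀ (p : M) (X Y Z : TangentSpace I p),
    curvatureTensor I S.g.inner p X Y Z =
      f₁ p • S.R₁ p X Y Z + f₂ p • S.R₂ p X Y Z + f₃ p • S.R₃ p X Y Z + f₄ p • S.R₄ p X Y Z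
        + f₅₁ p • S.R₅₁ p X Y Z + f₅₂ p • S.R₅₂ p X Y Z + f₆ p • S.R₆ p X Y Z

end AlmostContactMetricStructure

end Contact

section Submanifold

variable {n₁ n₂ m : ℕ}
  {M₁ : Type*} [TopologicalSpace M₁] [ChartedSpace (EuclideanSpace ℝ (Fin n₁)) M₁]
  [IsManifold (𝓡 n₁) ∞ M₁]
  {M₂ : Type*} [TopologicalSpace M₂] [ChartedSpace (EuclideanSpace ℝ (Fin n₂)) M₂]
  [IsManifold (𝓡 n₂) ∞ M₂]
  {N : Type*} [TopologicalSpace N] [ChartedSpace (EuclideanSpace ℝ (Fin (2 * m + 1))) N]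
  [IsManifold (𝓡 (2 * m + 1)) ∞ N]

variable (n₁ n₂ m M₁ M₂ N) in
/-- An isometric immersion `x` of a doubly warped product of two Riemannian manifolds `(M₁, g₁)`
and `(M₂, g₂)`, with warping functions `ρ₁`, `ρ₂`, into a `(2m+1)`-dimensional almost contact
metric manifold. -/
structure DoublyWarpedImmersion where
  S : AlmostContactMetricStructure (𝓡 (2 * m + 1)) N
  g₁ : ContMDiffRiemannianMetric (𝓡 n₁) ∞ (EuclideanSpace ℝ (Fin n₁))
    (fun p : M₁ => TangentSpace (𝓡 n₁) p)
  g₂ : ContMDiffRiemannianMetric (𝓡 n₂) ∞ (EuclideanSpace ℝ (Fin n₂))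
    (fun p : M₂ => TangentSpace (𝓡 n₂) p)
  ρ₁ : M₁ → ℝ
  ρ₂ : M₂ → ℝ
  contMDiff_ρ₁ : ContMDiff (𝓡 n₁) 𝓘(ℝ, ℝ) ∞ ρ₁
  contMDiff_ρ₂ : ContMDiff (𝓡 n₂) 𝓘(ℝ, ℝ) ∞ ρ₂
  ρ₁_pos : ∀ p, 0 < ρ₁ p
  ρ₂_pos : ∀ p, 0 < ρ₂ p
  x : M₁ × M₂ → N
  contMDiff_x : ContMDiff ((𝓡 n₁).prod (𝓡 n₂)) (𝓡 (2 * m + 1)) ∞ x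
  isometric : ∀ (p : M₁ × M₂) (u v : TangentSpace ((𝓡 n₁).prod (𝓡 n₂)) p),
    S.g.inner (x p) (mfderiv ((𝓡 n₁).prod (𝓡 n₂)) (𝓡 (2 * m + 1)) x p u)
        (mfderiv ((𝓡 n₁).prod (𝓡 n₂)) (𝓡 (2 * m + 1)) x p v)
      = doublyWarpedMetric (𝓡 n₁) (𝓡 n₂) g₁.inner g₂.inner ρ₁ ρ₂ p u v

namespace DoublyWarpedImmersion

variable (D : DoublyWarpedImmersion n₁ n₂ m M₁ M₂ N)

/-- The metric of the doubly warped product at `p`. -/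
def metric (p : M₁ × M₂) :
    EuclideanSpace ℝ (Fin n₁) × EuclideanSpace ℝ (Fin n₂) →L[ℝ]
      EuclideanSpace ℝ (Fin n₁) × EuclideanSpace ℝ (Fin n₂) →L[ℝ] ℝ :=
  doublyWarpedMetric (𝓡 n₁) (𝓡 n₂) D.g₁.inner D.g₂.inner D.ρ₁ D.ρ₂ p

/-- The metric at `p` of the leaf `M₁ × {p.2}`. -/
def metric₁ (p : M₁ × M₂) :
    EuclideanSpace ℝ (Fin n₁) →L[ℝ] EuclideanSpace ℝ (Fin n₁) →L[ℝ] ℝ :=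
  leafMetric₁ (𝓡 n₁) D.g₁.inner D.ρ₂ p.2 p.1

/-- The metric at `p` of the leaf `{p.1} × M₂`. -/
def metric₂ (p : M₁ × M₂) :
    EuclideanSpace ℝ (Fin n₂) →L[ℝ] EuclideanSpace ℝ (Fin n₂) →L[ℝ] ℝ :=
  leafMetric₂ (𝓡 n₂) D.g₂.inner D.ρ₁ p.1 p.2

/-- `Δ₁ ρ₁` at `p`, on the leaf `M₁ × {p.2}` with its induced metric. -/
def laplacian₁ (p : M₁ × M₂) : ℝ :=
  laplacian (𝓡 n₁) (leafMetric₁ (𝓡 n₁) D.g₁.inner D.ρ₂ p.2) D.ρ₁ p.1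

/-- `Δ₂ ρ₂` at `p`, on the leaf `{p.1} × M₂` with its induced metric. -/
def laplacian₂ (p : M₁ × M₂) : ℝ :=
  laplacian (𝓡 n₂) (leafMetric₂ (𝓡 n₂) D.g₂.inner D.ρ₁ p.1) D.ρ₂ p.2

/-- The differential of the immersion. -/
def dx (p : M₁ × M₂) (u : EuclideanSpace ℝ (Fin n₁) × EuclideanSpace ℝ (Fin n₂)) :
    TangentSpace (𝓡 (2 * m + 1)) (D.x p) :=
  mfderiv ((𝓡 n₁).prod (𝓡 n₂)) (𝓡 (2 * m + 1)) D.x p u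

/-- The second fundamental form of the immersion. -/
def σ (p : M₁ × M₂) (u v : EuclideanSpace ℝ (Fin n₁) × EuclideanSpace ℝ (Fin n₂)) :
    TangentSpace (𝓡 (2 * m + 1)) (D.x p) :=
  letI σuv : EuclideanSpace ℝ (Fin (2 * m + 1)) :=
    secondFundamentalForm ((𝓡 n₁).prod (𝓡 n₂)) (𝓡 (2 * m + 1))
      (doublyWarpedMetric (𝓡 n₁) (𝓡 n₂) D.g₁.inner D.g₂.inner D.ρ₁ D.ρ₂) D.S.g.inner D.x p u v
  σuv

/-- The submanifold is C-totally real: its tangent vectors lie in the contact distribution. -/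
def IsCTotallyReal : Prop :=
  ∀ (p : M₁ × M₂) (u : EuclideanSpace ℝ (Fin n₁) × EuclideanSpace ℝ (Fin n₂)),
    D.S.η (D.x p) (D.dx p u) = 0

/-- The mean curvature vector `H = (1/n) trace σ`, `n = n₁ + n₂`. -/
def meanCurvature (p : M₁ × M₂) : TangentSpace (𝓡 (2 * m + 1)) (D.x p) :=
  ((n₁ + n₂ : ℕ) : ℝ)⁻¹ • metricTrace (D.metric p) (D.σ p)

/-- The partial mean curvature vector `H₁ = (1/n₁) trace (σ restricted to M₁)`. -/
def meanCurvature₁ (p : M₁ × M₂) : TangentSpace (𝓡 (2 * m + 1)) (D.x p) :=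
  (n₁ : ℝ)⁻¹ • metricTrace (D.metric₁ p) (restrict₁ (D.σ p))

/-- The partial mean curvature vector `H₂ = (1/n₂) trace (σ restricted to M₂)`. -/
def meanCurvature₂ (p : M₁ × M₂) : TangentSpace (𝓡 (2 * m + 1)) (D.x p) :=
  (n₂ : ℝ)⁻¹ • metricTrace (D.metric₂ p) (restrict₂ (D.σ p))

/-- `M` is mixed totally geodesic: `σ(X, Z) = 0` for `X` tangent to `M₁` and `Z` tangent to `M₂`. -/
def IsMixedTotallyGeodesic : Prop :=
  ∀ (p : M₁ × M₂) (u : EuclideanSpace ℝ (Fin n₁)) (v : EuclideanSpace ℝ (Fin n₂)),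
    D.σ p (u, 0) (0, v) = 0

/-- The bilinear form `(u, v) ↦ ⟨h^T u, v⟩` of the tangential part `h^T` of `h`. -/
def hT (p : M₁ × M₂) (u v : EuclideanSpace ℝ (Fin n₁) × EuclideanSpace ℝ (Fin n₂)) : ℝ :=
  D.S.g.inner (D.x p) (D.S.h (D.x p) (D.dx p u)) (D.dx p v)

/-- The bilinear form `(u, v) ↦ ⟨A_ξ u, v⟩ = ⟨σ(u, v), ξ⟩` of the shape operator `A_ξ`. -/
def Aξ (p : M₁ × M₂) (u v : EuclideanSpace ℝ (Fin n₁) × EuclideanSpace ℝ (Fin n₂)) : ℝ :=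
  D.S.g.inner (D.x p) (D.σ p u v) (D.S.ξ (D.x p))

/-- For the bilinear form `B(u, v) = ⟨T u, v⟩` of a symmetric operator `T` on `T_pM`, the number
`(tr T)² - (tr T|M₁)² - (tr T|M₂)² - ‖T‖² + ‖T|M₁‖² + ‖T|M₂‖²`, where `T|Mᵢ` is the operator
on `T_pMᵢ` obtained from `T` by restriction followed by orthogonal projection to `T_pMᵢ`. -/
def traceNormDefect (p : M₁ × M₂)
    (B : EuclideanSpace ℝ (Fin n₁) × EuclideanSpace ℝ (Fin n₂) →
      EuclideanSpace ℝ (Fin n₁) × EuclideanSpace ℝ (Fin n₂) → ℝ) : ℝ :=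
  (metricTrace (D.metric p) B) ^ 2 - (metricTrace (D.metric₁ p) (restrict₁ B)) ^ 2
    - (metricTrace (D.metric₂ p) (restrict₂ B)) ^ 2
    - metricNormSq (D.metric p) B + metricNormSq (D.metric₁ p) (restrict₁ B)
    + metricNormSq (D.metric₂ p) (restrict₂ B)

/-- The left-hand side `n₂ Δ₁ρ₁/ρ₁ + n₁ Δ₂ρ₂/ρ₂` at `p`. -/
def warpingTerm (p : M₁ × M₂) : ℝ :=
  n₂ * (D.laplacian₁ p / D.ρ₁ p.1) + n₁ * (D.laplacian₂ p / D.ρ₂ p.2)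

/-- The upper bound at `p`, in terms of the functions `f₁, f₄, f₅₁, f₅₂`. -/
def upperBound (f₁ f₄ f₅₁ f₅₂ : N → ℝ) (p : M₁ × M₂) : ℝ :=
  ((n₁ + n₂ : ℕ) : ℝ) ^ 2 / 4 * D.S.g.inner (D.x p) (D.meanCurvature p) (D.meanCurvature p)
    + n₁ * n₂ * f₁ (D.x p)
    + f₄ (D.x p) * (n₂ * metricTrace (D.metric₁ p) (restrict₁ (D.hT p))
        + n₁ * metricTrace (D.metric₂ p) (restrict₂ (D.hT p)))
    + 1 / 2 * f₅₁ (D.x p) * D.traceNormDefect p (D.hT p)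
    + 1 / 2 * f₅₂ (D.x p) * D.traceNormDefect p (D.Aξ p)

end DoublyWarpedImmersion

end Submanifold

end

open Filter Topology

noncomputable section

set_option synthInstance.maxHeartbeats 400000
set_option maxHeartbeats 1000000
set_option linter.unusedSectionVars false

section Shortcuts

variable {E : Type*} [NormedAddCommGroup E] [NormedSpace ℝ E]

/-! Shortcuts for instance search. -/

instance : NormedAddCommGroup (E →L[ℝ] E →L[ℝ] ℝ) := ContinuousLinearMap.toNormedAddCommGroup

instance : NormedSpace ℝ (E →L[ℝ] E →L[ℝ] ℝ) := ContinuousLinearMap.toNormedSpace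

instance : AddCommGroup (E →L[ℝ] E →L[ℝ] ℝ) := ContinuousLinearMap.addCommGroup

instance : AddCommMonoid (E →L[ℝ] E →L[ℝ] ℝ) := ContinuousLinearMap.addCommMonoid

end Shortcuts

section CoordinateMetric

variable {E : Type*} [NormedAddCommGroup E] [NormedSpace ℝ E]

/-- The Koszul form: half of `(D_u G)(v, z) + (D_v G)(u, z) - (D_z G)(u, v)`. -/
def koszul (G : E → E →L[ℝ] E →L[ℝ] ℝ) (y u v z : E) : ℝ :=
  (1 / 2 : ℝ) * (fderiv ℝ G y u v z + fderiv ℝ G y v u z - fderiv ℝ G y z u v)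

theorem apply_christoffel {G : E → E →L[ℝ] E →L[ℝ] ℝ} {y : E} (hG : (G y).IsInvertible)
    (u v z : E) : G y (christoffel G y u v) z = koszul G y u v z := by
  obtain ⟨A, hA⟩ := hG
  simp only [christoffel, koszul, ← hA, ContinuousLinearMap.inverse_equiv]
  simp

/-- The Christoffel map as a continuous bilinear map. -/
def christoffelCLM [FiniteDimensional ℝ E] (G : E → E →L[ℝ] E →L[ℝ] ℝ) (y : E) :
    E →L[ℝ] E →L[ℝ] E :=
  LinearMap.toContinuousLinearMap (LinearMap.toContinuousLinearMap.toLinearMap ∘ₗ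
    LinearMap.mk₂ ℝ (christoffel G y)
      (fun u u' v => by
        simp only [christoffel]; rw [← map_add]; congr 1; ext z; simp; ring)
      (fun c u v => by
        simp only [christoffel]; rw [← map_smul]; congr 1; ext z; simp; ring)
      (fun u v v' => by
        simp only [christoffel]; rw [← map_add]; congr 1; ext z; simp; ring)
      (fun c u v => by
        simp only [christoffel]; rw [← map_smul]; congr 1; ext z; simp; ring))

theorem christoffelCLM_apply [FiniteDimensional ℝ E] (G : E → E →L[ℝ] E →L[ℝ] ℝ) (y u v : E) :
    christoffelCLM G y u v = christoffel G y u v := rfl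

/-- `G` is near `y₀` a smooth field of nondegenerate symmetric bilinear forms. -/
structure IsMetricAt (G : E → E →L[ℝ] E →L[ℝ] ℝ) (y₀ : E) : Prop where
  eventually_contDiffAt : ∀ᶠ y in 𝓝 y₀, ContDiffAt ℝ ∞ G y
  symm : ∀ᶠ y in 𝓝 y₀, ∀ u v, G y u v = G y v u
  isInvertible : ∀ᶠ y in 𝓝 y₀, (G y).IsInvertible

theorem IsMetricAt.contDiffAt {G : E → E →L[ℝ] E →L[ℝ] ℝ} {y₀ : E} (hG : IsMetricAt G y₀) :
    ContDiffAt ℝ ∞ G y₀ := hG.eventually_contDiffAt.self_of_nhds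

theorem isInvertible_of_pos [FiniteDimensional ℝ E] {b : E →L[ℝ] E →L[ℝ] ℝ}
    (hb : ∀ u, u ≠ 0 → 0 < b u u) : b.IsInvertible := by
  have hinj : Function.Injective (LinearMap.toContinuousLinearMap.symm.toLinearMap ∘ₗ
      b.toLinearMap : E →ₗ[ℝ] (E →ₗ[ℝ] ℝ)) := by
    rw [← LinearMap.ker_eq_bot, LinearMap.ker_eq_bot']
    intro u hu
    by_contra h
    have := hb u h
    have h2 : b u u = 0 := LinearMap.congr_fun hu u
    linarith
  let e : E ≃ₗ[ℝ] (E →L[ℝ] ℝ) :=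
    (LinearEquiv.ofInjectiveOfFinrankEq _ hinj (Subspace.dual_finrank_eq).symm).trans
      LinearMap.toContinuousLinearMap
  exact ⟨e.toContinuousLinearEquiv, by ext u v; rfl⟩

theorem IsMetricAt.eventually {G : E → E →L[ℝ] E →L[ℝ] ℝ} {y₀ : E} (hG : IsMetricAt G y₀) :
    ∀ᶠ y in 𝓝 y₀, IsMetricAt G y := by
  filter_upwards [hG.eventually_contDiffAt.eventually_nhds, hG.symm.eventually_nhds,
    hG.isInvertible.eventually_nhds] with y h1 h2 h3 using ⟨h1, h2, h3⟩

theorem IsMetricAt.differentiableAt {G : E → E →L[ℝ] E →L[ℝ] ℝ} {y₀ : E} (hG : IsMetricAt G y₀) :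
    DifferentiableAt ℝ G y₀ := hG.contDiffAt.differentiableAt (by simp)

theorem IsMetricAt.fderiv_symm {G : E → E →L[ℝ] E →L[ℝ] ℝ} {y₀ : E} (hG : IsMetricAt G y₀)
    (a u v : E) : fderiv ℝ G y₀ a u v = fderiv ℝ G y₀ a v u := by
  have hd := hG.differentiableAt.hasFDerivAt
  have h1 := (hd.clm_apply (hasFDerivAt_const u y₀)).clm_apply (hasFDerivAt_const v y₀)
  have h2 := (hd.clm_apply (hasFDerivAt_const v y₀)).clm_apply (hasFDerivAt_const u y₀)
  have h3 := h1.unique (h2.congr_of_eventuallyEq (by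
    filter_upwards [hG.symm] with y hy using hy u v))
  simpa using DFunLike.congr_fun h3 a

theorem contDiffAt_clm_iff [FiniteDimensional ℝ E] {W X : Type*} [NormedAddCommGroup W]
    [NormedSpace ℝ W] [NormedAddCommGroup X] [NormedSpace ℝ X] {n : WithTop ℕ∞}
    {f : X → E →L[ℝ] W} {x : X} :
    ContDiffAt ℝ n f x ↔ ∀ u, ContDiffAt ℝ n (fun y => f y u) x := by
  refine ⟨fun h u => h.clm_apply contDiffAt_const, fun h => ?_⟩
  have hd : Module.finrank ℝ E = Module.finrank ℝ (Fin (Module.finrank ℝ E) → ℝ) :=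
    (Module.finrank_fin_fun ℝ).symm
  let e₁ := ContinuousLinearEquiv.ofFinrankEq hd
  let e₂ := (e₁.arrowCongr (1 : W ≃L[ℝ] W)).trans
    (ContinuousLinearEquiv.piRing (Fin (Module.finrank ℝ E)))
  rw [← Function.id_comp f, ← e₂.symm_comp_self]
  exact e₂.symm.contDiff.contDiffAt.comp x (contDiffAt_pi.mpr fun i => h _)

theorem IsMetricAt.contDiffAt_christoffelCLM [FiniteDimensional ℝ E]
    {G : E → E →L[ℝ] E →L[ℝ] ℝ} {y₀ : E} (hG : IsMetricAt G y₀) :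
    ContDiffAt ℝ ∞ (christoffelCLM G) y₀ := by
  have hd2 : ∀ u v w, ContDiffAt ℝ ∞ (fun y => fderiv ℝ G y u v w) y₀ := by
    intro u v w
    have h0 : ContDiffAt ℝ ∞ (fun y => G y v w) y₀ :=
      contDiffAt_clm_iff.1 (contDiffAt_clm_iff.1 hG.contDiffAt v) w
    have h1 : ContDiffAt ℝ ∞ (fderiv ℝ (fun y => G y v w)) y₀ := h0.fderiv_right (by simp)
    refine (h1.clm_apply (contDiffAt_const (c := u))).congr_of_eventuallyEq ?_
    filter_upwards [hG.eventually] with y hy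
    have h2 := (hy.differentiableAt.hasFDerivAt.clm_apply (hasFDerivAt_const v y)).clm_apply
      (hasFDerivAt_const w y)
    rw [h2.fderiv]
    simp
  have hi : ContDiffAt ℝ ∞ (fun y => (G y).inverse) y₀ :=
    haveI := FiniteDimensional.complete ℝ E
    (hG.isInvertible.self_of_nhds.contDiffAt_map_inverse).comp y₀ hG.contDiffAt
  rw [contDiffAt_clm_iff]
  intro u
  rw [contDiffAt_clm_iff]
  intro v
  refine hi.clm_apply ?_
  rw [contDiffAt_clm_iff]
  intro z
  exact (((hd2 u v z).add (hd2 v u z)).sub (hd2 z u v)).const_smul (1 / 2 : ℝ)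

theorem IsMetricAt.fderiv_apply {G : E → E →L[ℝ] E →L[ℝ] ℝ} {y₀ : E} (hG : IsMetricAt G y₀)
    (a b c : E) : fderiv ℝ G y₀ a b c =
      G y₀ (christoffel G y₀ a b) c + G y₀ b (christoffel G y₀ a c) := by
  rw [hG.symm.self_of_nhds b, apply_christoffel hG.isInvertible.self_of_nhds,
    apply_christoffel hG.isInvertible.self_of_nhds, koszul, koszul, hG.fderiv_symm c a b,
    hG.fderiv_symm a c b, hG.fderiv_symm b a c]
  ring

theorem IsMetricAt.christoffel_symm {G : E → E →L[ℝ] E →L[ℝ] ℝ} {y₀ : E} (hG : IsMetricAt G y₀)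
    (u v : E) : christoffel G y₀ u v = christoffel G y₀ v u := by
  rw [christoffel, christoffel]
  congr 2
  ext z
  simp [hG.fderiv_symm z u v]
  ring

theorem christoffel_const_smul {G : E → E →L[ℝ] E →L[ℝ] ℝ} {y : E} (hG : (G y).IsInvertible)
    (c : ℝ) (hc : c ≠ 0) (u v : E) :
    christoffel (fun z => c • G z) y u v = christoffel G y u v := by
  obtain ⟨A, hA⟩ := hG
  have h1 : (c • G y).IsInvertible :=
    ⟨A.trans (ContinuousLinearEquiv.smulLeft (Units.mk0 c hc)), by ext; simp [← hA]⟩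
  obtain ⟨B, hB⟩ := id h1
  have : Function.Injective (c • G y) := by rw [← hB]; exact B.injective
  apply this
  ext z
  have h2 := apply_christoffel (G := fun z => c • G z) h1 u v z
  have h3 := apply_christoffel (G := G) (y := y) ⟨A, hA⟩ u v z
  refine h2.trans ?_
  simp only [smul_apply, h3, koszul]
  have : fderiv ℝ (fun z => c • G z) y = c • fderiv ℝ G y := 
    congrFun (fderiv_const_smul_field (𝕜 := ℝ) (R := ℝ) (f := G) c) y
  rw [this]
  simp
  ring

variable {E' : Type*} [NormedAddCommGroup E'] [NormedSpace ℝ E']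

/-- `∇'_u (DF v)` for a map `F` into the domain of the metric `G'`. -/
def pushCovDeriv (G' : E' → E' →L[ℝ] E' →L[ℝ] ℝ) (F : E → E') (y u v : E) : E' :=
  fderiv ℝ (fderiv ℝ F) y u v + christoffel G' (F y) (fderiv ℝ F y u) (fderiv ℝ F y v)

theorem apply_pushCovDeriv {G : E → E →L[ℝ] E →L[ℝ] ℝ} {G' : E' → E' →L[ℝ] E' →L[ℝ] ℝ}
    {F : E → E'} {y₀ : E} (hG' : IsMetricAt G' (F y₀)) (hF : ContDiffAt ℝ ∞ F y₀)
    (hpull : ∀ᶠ y in 𝓝 y₀, ∀ u v, G y u v = G' (F y) (fderiv ℝ F y u) (fderiv ℝ F y v))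
    (hGd : DifferentiableAt ℝ G y₀) (u v z : E) :
    G' (F y₀) (pushCovDeriv G' F y₀ u v) (fderiv ℝ F y₀ z) = koszul G y₀ u v z := by
  have hF1 : ContDiffAt ℝ ∞ (fderiv ℝ F) y₀ := hF.fderiv_right (by simp)
  have hF1' := (hF1.differentiableAt (by simp)).hasFDerivAt
  have hF' := (hF.differentiableAt (by simp)).hasFDerivAt
  have hsymm : ∀ a b, fderiv ℝ (fderiv ℝ F) y₀ a b = fderiv ℝ (fderiv ℝ F) y₀ b a := by
    intro a b
    exact (hF.isSymmSndFDerivAt (by simp [ENat.LEInfty.out])) a b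
  have hDG : ∀ a b c, fderiv ℝ G y₀ a b c =
      fderiv ℝ G' (F y₀) (fderiv ℝ F y₀ a) (fderiv ℝ F y₀ b) (fderiv ℝ F y₀ c)
      + G' (F y₀) (fderiv ℝ (fderiv ℝ F) y₀ a b) (fderiv ℝ F y₀ c)
      + G' (F y₀) (fderiv ℝ F y₀ b) (fderiv ℝ (fderiv ℝ F) y₀ a c) := by
    intro a b c
    have h1 := (hGd.hasFDerivAt.clm_apply (hasFDerivAt_const b y₀)).clm_apply
      (hasFDerivAt_const c y₀)
    have hGF : HasFDerivAt (fun y => G' (F y)) ((fderiv ℝ G' (F y₀)).comp (fderiv ℝ F y₀)) y₀ :=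
      HasFDerivAt.comp (g := G') y₀ hG'.differentiableAt.hasFDerivAt hF'
    have h2 := (hGF.clm_apply
      (hF1'.clm_apply (hasFDerivAt_const b y₀))).clm_apply
      (hF1'.clm_apply (hasFDerivAt_const c y₀))
    have h3 := h1.unique (h2.congr_of_eventuallyEq (by
      filter_upwards [hpull] with y hy using hy b c))
    have h4 := DFunLike.congr_fun h3 a
    simp at h4
    rw [h4]
    ring
  have hk := apply_christoffel hG'.isInvertible.self_of_nhds (fderiv ℝ F y₀ u) (fderiv ℝ F y₀ v)
    (fderiv ℝ F y₀ z)
  rw [pushCovDeriv, map_add, add_apply, hk, koszul, koszul, hDG, hDG, hDG,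
    hsymm z u, hsymm z v, hsymm v u,
    hG'.symm.self_of_nhds (fderiv ℝ F y₀ v), hG'.symm.self_of_nhds (fderiv ℝ F y₀ u)]
  ring

theorem pullback_curvature [FiniteDimensional ℝ E'] {G : E → E →L[ℝ] E →L[ℝ] ℝ}
    {G' : E' → E' →L[ℝ] E' →L[ℝ] ℝ}
    {F : E → E'} {y₀ : E} (hG' : IsMetricAt G' (F y₀)) (hFe : ∀ᶠ y in 𝓝 y₀, ContDiffAt ℝ ∞ F y)
    (hpull : ∀ᶠ y in 𝓝 y₀, ∀ u v, G y u v = G' (F y) (fderiv ℝ F y u) (fderiv ℝ F y v))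
    (hGd : ∀ᶠ y in 𝓝 y₀, ContDiffAt ℝ ∞ G y) (u v w z : E) :
    G' (F y₀) (coordCurvature G' (F y₀) (fderiv ℝ F y₀ u) (fderiv ℝ F y₀ v) (fderiv ℝ F y₀ w))
        (fderiv ℝ F y₀ z) =
      fderiv ℝ (fun y => koszul G y v w z) y₀ u - fderiv ℝ (fun y => koszul G y u w z) y₀ v
      - G' (F y₀) (pushCovDeriv G' F y₀ v w) (pushCovDeriv G' F y₀ u z)
      + G' (F y₀) (pushCovDeriv G' F y₀ u w) (pushCovDeriv G' F y₀ v z) := by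
  have hF := hFe.self_of_nhds
  have hF1 : ContDiffAt ℝ ∞ (fderiv ℝ F) y₀ := hF.fderiv_right (by simp)
  have hF2 : ContDiffAt ℝ ∞ (fderiv ℝ (fderiv ℝ F)) y₀ := hF1.fderiv_right (by simp)
  have hF' := (hF.differentiableAt (by simp)).hasFDerivAt
  have hF1' := (hF1.differentiableAt (by simp)).hasFDerivAt
  have hF2' := (hF2.differentiableAt (by simp)).hasFDerivAt
  have hΓ := (hG'.contDiffAt_christoffelCLM.differentiableAt (by simp)).hasFDerivAt
  have hsymm : ∀ a b, fderiv ℝ (fderiv ℝ F) y₀ a b = fderiv ℝ (fderiv ℝ F) y₀ b a :=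
    fun a b => (hF.isSymmSndFDerivAt (by simp [ENat.LEInfty.out])) a b
  have hsymm3 : ∀ a b, fderiv ℝ (fderiv ℝ (fderiv ℝ F)) y₀ a b
      = fderiv ℝ (fderiv ℝ (fderiv ℝ F)) y₀ b a :=
    fun a b => (hF1.isSymmSndFDerivAt (by simp [ENat.LEInfty.out])) a b
  have hk : ∀ a b c, fderiv ℝ (fun y => koszul G y b c z) y₀ a =
      G' (F y₀) (fderiv ℝ (fderiv ℝ (fderiv ℝ F)) y₀ a b c
        + fderiv ℝ (christoffelCLM G') (F y₀) (fderiv ℝ F y₀ a) (fderiv ℝ F y₀ b) (fderiv ℝ F y₀ c)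
        + christoffel G' (F y₀) (fderiv ℝ (fderiv ℝ F) y₀ a b) (fderiv ℝ F y₀ c)
        + christoffel G' (F y₀) (fderiv ℝ F y₀ b) (fderiv ℝ (fderiv ℝ F) y₀ a c)
        + christoffel G' (F y₀) (fderiv ℝ F y₀ a) (pushCovDeriv G' F y₀ b c)) (fderiv ℝ F y₀ z)
      + G' (F y₀) (pushCovDeriv G' F y₀ b c) (pushCovDeriv G' F y₀ a z) := by
    intro a b c
    have hΓF : HasFDerivAt (fun y => christoffelCLM G' (F y))
      ((fderiv ℝ (christoffelCLM G') (F y₀)).comp (fderiv ℝ F y₀)) y₀ :=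
      HasFDerivAt.comp (g := christoffelCLM G') y₀ hΓ hF'
    have hV : HasFDerivAt (fun y => fderiv ℝ (fderiv ℝ F) y b c
        + christoffelCLM G' (F y) (fderiv ℝ F y b) (fderiv ℝ F y c)) _ y₀ :=
      ((hF2'.clm_apply (hasFDerivAt_const b y₀)).clm_apply (hasFDerivAt_const c y₀)).add
      ((hΓF.clm_apply (hF1'.clm_apply (hasFDerivAt_const b y₀))).clm_apply
        (hF1'.clm_apply (hasFDerivAt_const c y₀)))
    have hGF : HasFDerivAt (fun y => G' (F y)) ((fderiv ℝ G' (F y₀)).comp (fderiv ℝ F y₀)) y₀ :=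
      HasFDerivAt.comp (g := G') y₀ hG'.differentiableAt.hasFDerivAt hF'
    have h2 := (hGF.clm_apply hV).clm_apply
      (hF1'.clm_apply (hasFDerivAt_const z y₀))
    have h3 := h2.congr_of_eventuallyEq (f₁ := fun y => koszul G y b c z) (by
      filter_upwards [hF.continuousAt.eventually hG'.eventually, hFe,
        hpull.eventually_nhds, hGd] with y h1 h2 h3 h4
      rw [← apply_pushCovDeriv h1 h2 h3 (h4.differentiableAt (by simp)), pushCovDeriv,
        ← christoffelCLM_apply])
    rw [h3.fderiv]
    simp [christoffelCLM_apply]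
    simp only [hG'.fderiv_apply, pushCovDeriv]
    simp only [map_add, add_apply]
    simp only [← christoffelCLM_apply, map_add, add_apply]
    ring
  have hc : ∀ a b c, fderiv ℝ (fun z => christoffel G' z b c) (F y₀) a
      = fderiv ℝ (christoffelCLM G') (F y₀) a b c := by
    intro a b c
    have := ((hΓ.clm_apply (hasFDerivAt_const b (F y₀))).clm_apply
      (hasFDerivAt_const c (F y₀))).fderiv
    simp only [christoffelCLM_apply] at this
    rw [this]
    simp
  rw [hk, hk, coordCurvature, hc, hc, hsymm3 v u, hsymm v u]
  simp only [pushCovDeriv, ← christoffelCLM_apply, map_add, map_sub, add_apply,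
    sub_apply]
  ring

end CoordinateMetric

section Gauss

variable {E : Type*} [NormedAddCommGroup E] [NormedSpace ℝ E]
  {E' : Type*} [NormedAddCommGroup E'] [NormedSpace ℝ E']

/-- The normal part of `∇'_u (DF v)`. -/
def coordSecondFundamentalForm (G : E → E →L[ℝ] E →L[ℝ] ℝ) (G' : E' → E' →L[ℝ] E' →L[ℝ] ℝ)
    (F : E → E') (y u v : E) : E' :=
  pushCovDeriv G' F y u v - fderiv ℝ F y (christoffel G y u v)

theorem coordSecondFundamentalForm_orthogonal
    {G : E → E →L[ℝ] E →L[ℝ] ℝ} {G' : E' → E' →L[ℝ] E' →L[ℝ] ℝ}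
    {F : E → E'} {y₀ : E} (hG : IsMetricAt G y₀) (hG' : IsMetricAt G' (F y₀))
    (hF : ContDiffAt ℝ ∞ F y₀)
    (hpull : ∀ᶠ y in 𝓝 y₀, ∀ u v, G y u v = G' (F y) (fderiv ℝ F y u) (fderiv ℝ F y v))
    (u v z : E) :
    G' (F y₀) (coordSecondFundamentalForm G G' F y₀ u v) (fderiv ℝ F y₀ z) = 0 := by
  rw [coordSecondFundamentalForm, map_sub, sub_apply,
    apply_pushCovDeriv hG' hF hpull hG.differentiableAt, ← hpull.self_of_nhds,
    apply_christoffel hG.isInvertible.self_of_nhds, sub_self]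

theorem coordSecondFundamentalForm_symm
    {G : E → E →L[ℝ] E →L[ℝ] ℝ} {G' : E' → E' →L[ℝ] E' →L[ℝ] ℝ}
    {F : E → E'} {y₀ : E} (hG : IsMetricAt G y₀) (hG' : IsMetricAt G' (F y₀))
    (hF : ContDiffAt ℝ ∞ F y₀) (u v : E) :
    coordSecondFundamentalForm G G' F y₀ u v = coordSecondFundamentalForm G G' F y₀ v u := by
  have hsymm : fderiv ℝ (fderiv ℝ F) y₀ u v = fderiv ℝ (fderiv ℝ F) y₀ v u :=
    (hF.isSymmSndFDerivAt (by simp [ENat.LEInfty.out])) u v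
  rw [coordSecondFundamentalForm, coordSecondFundamentalForm, pushCovDeriv, pushCovDeriv, hsymm,
    hG.christoffel_symm, hG'.christoffel_symm]

theorem apply_pushCovDeriv_pushCovDeriv
    {G : E → E →L[ℝ] E →L[ℝ] ℝ} {G' : E' → E' →L[ℝ] E' →L[ℝ] ℝ}
    {F : E → E'} {y₀ : E} (hG : IsMetricAt G y₀) (hG' : IsMetricAt G' (F y₀))
    (hF : ContDiffAt ℝ ∞ F y₀)
    (hpull : ∀ᶠ y in 𝓝 y₀, ∀ u v, G y u v = G' (F y) (fderiv ℝ F y u) (fderiv ℝ F y v))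
    (u v w z : E) :
    G' (F y₀) (pushCovDeriv G' F y₀ u v) (pushCovDeriv G' F y₀ w z) =
      G y₀ (christoffel G y₀ u v) (christoffel G y₀ w z)
      + G' (F y₀) (coordSecondFundamentalForm G G' F y₀ u v)
          (coordSecondFundamentalForm G G' F y₀ w z) := by
  have h : ∀ a b, pushCovDeriv G' F y₀ a b
      = fderiv ℝ F y₀ (christoffel G y₀ a b) + coordSecondFundamentalForm G G' F y₀ a b := by
    intro a b
    rw [coordSecondFundamentalForm]
    abel
  rw [h u v, h w z]
  simp only [map_add, add_apply, ← hpull.self_of_nhds,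
    coordSecondFundamentalForm_orthogonal hG hG' hF hpull]
  rw [hG'.symm.self_of_nhds (fderiv ℝ F y₀ _) (coordSecondFundamentalForm G G' F y₀ w z),
    coordSecondFundamentalForm_orthogonal hG hG' hF hpull]
  ring

end Gauss

section Warped

variable {E₁ : Type*} [NormedAddCommGroup E₁] [NormedSpace ℝ E₁]
  {E₂ : Type*} [NormedAddCommGroup E₂] [NormedSpace ℝ E₂]

theorem fderiv_warped {G : E₁ × E₂ → E₁ × E₂ →L[ℝ] E₁ × E₂ →L[ℝ] ℝ}
    {G₁ : E₁ → E₁ →L[ℝ] E₁ →L[ℝ] ℝ} {G₂ : E₂ → E₂ →L[ℝ] E₂ →L[ℝ] ℝ} {r₁ : E₁ → ℝ} {r₂ : E₂ → ℝ}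
    {y : E₁ × E₂} (hG : DifferentiableAt ℝ G y) (hG₁ : DifferentiableAt ℝ G₁ y.1)
    (hG₂ : DifferentiableAt ℝ G₂ y.2) (hr₁ : DifferentiableAt ℝ r₁ y.1)
    (hr₂ : DifferentiableAt ℝ r₂ y.2)
    (h : ∀ᶠ z in 𝓝 y, ∀ u v, G z u v = r₂ z.2 ^ 2 * G₁ z.1 u.1 v.1 + r₁ z.1 ^ 2 * G₂ z.2 u.2 v.2)
    (c u v : E₁ × E₂) :
    fderiv ℝ G y c u v = 2 * r₂ y.2 * fderiv ℝ r₂ y.2 c.2 * G₁ y.1 u.1 v.1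
      + r₂ y.2 ^ 2 * fderiv ℝ G₁ y.1 c.1 u.1 v.1
      + 2 * r₁ y.1 * fderiv ℝ r₁ y.1 c.1 * G₂ y.2 u.2 v.2
      + r₁ y.1 ^ 2 * fderiv ℝ G₂ y.2 c.2 u.2 v.2 := by
  have h1 := (hG.hasFDerivAt.clm_apply (hasFDerivAt_const u y)).clm_apply (hasFDerivAt_const v y)
  have hs1 : HasFDerivAt (fun z : E₁ × E₂ => G₁ z.1 u.1 v.1) _ y :=
    HasFDerivAt.comp (g := fun z => G₁ z u.1 v.1) y ((hG₁.hasFDerivAt.clm_apply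
      (hasFDerivAt_const u.1 y.1)).clm_apply (hasFDerivAt_const v.1 y.1)) hasFDerivAt_fst
  have hs2 : HasFDerivAt (fun z : E₁ × E₂ => G₂ z.2 u.2 v.2) _ y :=
    HasFDerivAt.comp (g := fun z => G₂ z u.2 v.2) y ((hG₂.hasFDerivAt.clm_apply
      (hasFDerivAt_const u.2 y.2)).clm_apply (hasFDerivAt_const v.2 y.2)) hasFDerivAt_snd
  have hq1 : HasFDerivAt (fun z : E₁ × E₂ => r₁ z.1) _ y :=
    HasFDerivAt.comp (g := r₁) y hr₁.hasFDerivAt hasFDerivAt_fst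
  have hq2 : HasFDerivAt (fun z : E₁ × E₂ => r₂ z.2) _ y :=
    HasFDerivAt.comp (g := r₂) y hr₂.hasFDerivAt hasFDerivAt_snd
  have h2 := ((hq2.pow 2).mul hs1).add ((hq1.pow 2).mul hs2)
  have h3 := h1.unique (h2.congr_of_eventuallyEq (by
    filter_upwards [h] with z hz using hz u v))
  have h4 := DFunLike.congr_fun h3 c
  simp at h4
  rw [h4]
  ring

theorem warped_curvature {G : E₁ × E₂ → E₁ × E₂ →L[ℝ] E₁ × E₂ →L[ℝ] ℝ}
    {G₁ : E₁ → E₁ →L[ℝ] E₁ →L[ℝ] ℝ} {G₂ : E₂ → E₂ →L[ℝ] E₂ →L[ℝ] ℝ} {r₁ : E₁ → ℝ} {r₂ : E₂ → ℝ}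
    {a : E₁} {b : E₂} (hG : IsMetricAt G (a, b)) (hG₁ : IsMetricAt G₁ a)
    (hG₂ : IsMetricAt G₂ b) (hr₁ : ∀ᶠ z in 𝓝 a, ContDiffAt ℝ ∞ r₁ z)
    (hr₂ : ∀ᶠ z in 𝓝 b, ContDiffAt ℝ ∞ r₂ z) (h₁ : r₁ a ≠ 0) (h₂ : r₂ b ≠ 0)
    (h : ∀ᶠ z in 𝓝 (a, b), ∀ u v,
      G z u v = r₂ z.2 ^ 2 * G₁ z.1 u.1 v.1 + r₁ z.1 ^ 2 * G₂ z.2 u.2 v.2)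
    (X : E₁) (Z : E₂) :
    fderiv ℝ (fun y => koszul G y (0, Z) (0, Z) (X, 0)) (a, b) (X, 0)
      - fderiv ℝ (fun y => koszul G y (X, 0) (0, Z) (X, 0)) (a, b) (0, Z)
      - G (a, b) (christoffel G (a, b) (0, Z) (0, Z)) (christoffel G (a, b) (X, 0) (X, 0))
      + G (a, b) (christoffel G (a, b) (X, 0) (0, Z)) (christoffel G (a, b) (X, 0) (0, Z))
    = - r₁ a * G₂ b Z Z * (fderiv ℝ (fderiv ℝ r₁) a X X - fderiv ℝ r₁ a (christoffel G₁ a X X))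
      - r₂ b * G₁ a X X * (fderiv ℝ (fderiv ℝ r₂) b Z Z - fderiv ℝ r₂ b (christoffel G₂ b Z Z)) := by
  have hfst : Tendsto (Prod.fst : E₁ × E₂ → E₁) (𝓝 (a, b)) (𝓝 a) := continuous_fst.tendsto (a, b)
  have hsnd : Tendsto (Prod.snd : E₁ × E₂ → E₂) (𝓝 (a, b)) (𝓝 b) := continuous_snd.tendsto (a, b)
  have hD : ∀ᶠ y in 𝓝 (a, b), ∀ c u v,
      fderiv ℝ G y c u v = 2 * r₂ y.2 * fderiv ℝ r₂ y.2 c.2 * G₁ y.1 u.1 v.1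
      + r₂ y.2 ^ 2 * fderiv ℝ G₁ y.1 c.1 u.1 v.1
      + 2 * r₁ y.1 * fderiv ℝ r₁ y.1 c.1 * G₂ y.2 u.2 v.2
      + r₁ y.1 ^ 2 * fderiv ℝ G₂ y.2 c.2 u.2 v.2 := by
    filter_upwards [hG.eventually, hfst.eventually hG₁.eventually, hsnd.eventually hG₂.eventually,
      hfst.eventually hr₁, hsnd.eventually hr₂, h.eventually_nhds] with y k1 k2 k3 k4 k5 k6
    exact fderiv_warped k1.differentiableAt k2.differentiableAt k3.differentiableAt
      (k4.differentiableAt (by simp)) (k5.differentiableAt (by simp)) k6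
  have hr1 := (hr₁.self_of_nhds.differentiableAt (by simp)).hasFDerivAt
  have hr2 := (hr₂.self_of_nhds.differentiableAt (by simp)).hasFDerivAt
  have hr1' := ((hr₁.self_of_nhds.fderiv_right (m := ∞) (by simp)).differentiableAt
    (by simp)).hasFDerivAt
  have hr2' := ((hr₂.self_of_nhds.fderiv_right (m := ∞) (by simp)).differentiableAt
    (by simp)).hasFDerivAt
  have hs1 : HasFDerivAt (fun z : E₁ × E₂ => G₁ z.1 X X) _ (a, b) :=
    HasFDerivAt.comp (g := fun z => G₁ z X X) (a, b) ((hG₁.differentiableAt.hasFDerivAt.clm_apply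
      (hasFDerivAt_const X a)).clm_apply (hasFDerivAt_const X a)) hasFDerivAt_fst
  have hs2 : HasFDerivAt (fun z : E₁ × E₂ => G₂ z.2 Z Z) _ (a, b) :=
    HasFDerivAt.comp (g := fun z => G₂ z Z Z) (a, b) ((hG₂.differentiableAt.hasFDerivAt.clm_apply
      (hasFDerivAt_const Z b)).clm_apply (hasFDerivAt_const Z b)) hasFDerivAt_snd
  have hq1 : HasFDerivAt (fun z : E₁ × E₂ => r₁ z.1) _ (a, b) :=
    HasFDerivAt.comp (g := r₁) (a, b) hr1 hasFDerivAt_fst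
  have hq2 : HasFDerivAt (fun z : E₁ × E₂ => r₂ z.2) _ (a, b) :=
    HasFDerivAt.comp (g := r₂) (a, b) hr2 hasFDerivAt_snd
  have hp1 : HasFDerivAt (fun z : E₁ × E₂ => fderiv ℝ r₁ z.1 X) _ (a, b) :=
    HasFDerivAt.comp (g := fun z => fderiv ℝ r₁ z X) (a, b)
      (hr1'.clm_apply (hasFDerivAt_const X a)) hasFDerivAt_fst
  have hp2 : HasFDerivAt (fun z : E₁ × E₂ => fderiv ℝ r₂ z.2 Z) _ (a, b) :=
    HasFDerivAt.comp (g := fun z => fderiv ℝ r₂ z Z) (a, b)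
      (hr2'.clm_apply (hasFDerivAt_const Z b)) hasFDerivAt_snd
  have hk1 : fderiv ℝ (fun y => koszul G y (0, Z) (0, Z) (X, 0)) (a, b) (X, 0) =
      - (fderiv ℝ r₁ a X ^ 2 + r₁ a * fderiv ℝ (fderiv ℝ r₁) a X X) * G₂ b Z Z := by
    have := ((hq1.mul hp1).mul hs2).neg.congr_of_eventuallyEq
      (f₁ := fun y => koszul G y (0, Z) (0, Z) (X, 0)) (by
        filter_upwards [hD] with y hy
        simp only [koszul, hy]
        simp
        ring)
    rw [this.fderiv]
    simp
    ring
  have hk2 : fderiv ℝ (fun y => koszul G y (X, 0) (0, Z) (X, 0)) (a, b) (0, Z) =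
      (fderiv ℝ r₂ b Z ^ 2 + r₂ b * fderiv ℝ (fderiv ℝ r₂) b Z Z) * G₁ a X X := by
    have := ((hq2.mul hp2).mul hs1).congr_of_eventuallyEq
      (f₁ := fun y => koszul G y (X, 0) (0, Z) (X, 0)) (by
        filter_upwards [hD] with y hy
        simp only [koszul, hy]
        simp
        ring)
    rw [this.fderiv]
    simp
    ring
  have hD0 := hD.self_of_nhds
  have h0 := h.self_of_nhds
  have hinv := hG.isInvertible.self_of_nhds
  have hdec : ∀ u v, G (a, b) u v = G (a, b) u (v.1, 0) + G (a, b) u (0, v.2) := by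
    intro u v
    rw [← map_add]
    simp
  have key : ∀ u v z, G (a, b) (christoffel G (a, b) u v) z = koszul G (a, b) u v z :=
    fun u v z => apply_christoffel hinv u v z
  set w := christoffel G (a, b) (X, 0) (X, 0) with hw
  set s := christoffel G (a, b) (0, Z) (0, Z) with hs
  set t := christoffel G (a, b) (X, 0) (0, Z) with ht
  have hw1 : w.1 = christoffel G₁ a X X := by
    obtain ⟨A, hA⟩ := hG₁.isInvertible.self_of_nhds
    apply A.injective
    have hA' : ∀ x, A x = G₁ a x := fun x => by rw [← hA]; rfl
    rw [hA', hA']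
    ext x
    rw [apply_christoffel ⟨A, hA⟩]
    have h5 := key (X, 0) (X, 0) (x, 0)
    rw [← hw, h0, koszul] at h5
    simp [hD0] at h5
    have h6 : r₂ b ^ 2 * (G₁ a w.1 x) = r₂ b ^ 2 * koszul G₁ a X X x := by
      rw [h5, koszul]
      ring
    exact mul_left_cancel₀ (pow_ne_zero 2 h₂) h6
  have hs2 : s.2 = christoffel G₂ b Z Z := by
    obtain ⟨A, hA⟩ := hG₂.isInvertible.self_of_nhds
    apply A.injective
    have hA' : ∀ x, A x = G₂ b x := fun x => by rw [← hA]; rfl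
    rw [hA', hA']
    ext x
    rw [apply_christoffel ⟨A, hA⟩]
    have h5 := key (0, Z) (0, Z) (0, x)
    rw [← hs, h0, koszul] at h5
    simp [hD0] at h5
    have h6 : r₁ a ^ 2 * (G₂ b s.2 x) = r₁ a ^ 2 * koszul G₂ b Z Z x := by
      rw [h5, koszul]
      ring
    exact mul_left_cancel₀ (pow_ne_zero 2 h₁) h6
  have e1 : G (a, b) s w = - r₁ a * fderiv ℝ r₁ a w.1 * G₂ b Z Z
      - r₂ b * fderiv ℝ r₂ b s.2 * G₁ a X X := by
    rw [hdec]
    have h5 : G (a, b) s (w.1, 0) = - r₁ a * fderiv ℝ r₁ a w.1 * G₂ b Z Z := by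
      rw [hs, key, koszul]
      simp [hD0]
      ring
    have h6 : G (a, b) s (0, w.2) = - r₂ b * fderiv ℝ r₂ b s.2 * G₁ a X X := by
      have h7 : G (a, b) s (0, w.2) = G (a, b) w (0, s.2) := by
        rw [h0, h0, hG₂.symm.self_of_nhds]
        simp
      rw [h7, hw, key, koszul]
      simp [hD0]
      ring
    rw [h5, h6]
    ring
  have e2 : G (a, b) t t = fderiv ℝ r₂ b Z ^ 2 * G₁ a X X + fderiv ℝ r₁ a X ^ 2 * G₂ b Z Z := by
    have h5 : ∀ x, r₂ b ^ 2 * G₁ a t.1 x = r₂ b * fderiv ℝ r₂ b Z * G₁ a X x := by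
      intro x
      have := key (X, 0) (0, Z) (x, 0)
      rw [← ht, h0, koszul] at this
      simp [hD0] at this
      rw [this]
      ring
    have h6 : ∀ x, r₁ a ^ 2 * G₂ b t.2 x = r₁ a * fderiv ℝ r₁ a X * G₂ b Z x := by
      intro x
      have := key (X, 0) (0, Z) (0, x)
      rw [← ht, h0, koszul] at this
      simp [hD0] at this
      rw [this]
      ring
    have h7 : r₂ b * G₁ a t.1 X = fderiv ℝ r₂ b Z * G₁ a X X :=
      mul_left_cancel₀ h₂ (by linear_combination h5 X)
    have h8 : r₁ a * G₂ b t.2 Z = fderiv ℝ r₁ a X * G₂ b Z Z :=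
      mul_left_cancel₀ h₁ (by linear_combination h6 Z)
    rw [h0, h5, h6, hG₁.symm.self_of_nhds X, hG₂.symm.self_of_nhds Z]
    linear_combination fderiv ℝ r₂ b Z * h7 + fderiv ℝ r₁ a X * h8
  rw [hk1, hk2, e1, e2, hw1, hs2]
  ring

/-- The Gauss equation for an isometric immersion of a doubly warped product. -/
theorem gauss_warped {E' : Type*} [NormedAddCommGroup E'] [NormedSpace ℝ E']
    [FiniteDimensional ℝ E'] {G : E₁ × E₂ → E₁ × E₂ →L[ℝ] E₁ × E₂ →L[ℝ] ℝ}
    {G₁ : E₁ → E₁ →L[ℝ] E₁ →L[ℝ] ℝ} {G₂ : E₂ → E₂ →L[ℝ] E₂ →L[ℝ] ℝ} {r₁ : E₁ → ℝ} {r₂ : E₂ → ℝ}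
    {a : E₁} {b : E₂} (hG : IsMetricAt G (a, b)) (hG₁ : IsMetricAt G₁ a)
    (hG₂ : IsMetricAt G₂ b) (hr₁ : ∀ᶠ z in 𝓝 a, ContDiffAt ℝ ∞ r₁ z)
    (hr₂ : ∀ᶠ z in 𝓝 b, ContDiffAt ℝ ∞ r₂ z) (h₁ : r₁ a ≠ 0) (h₂ : r₂ b ≠ 0)
    (h : ∀ᶠ z in 𝓝 (a, b), ∀ u v,
      G z u v = r₂ z.2 ^ 2 * G₁ z.1 u.1 v.1 + r₁ z.1 ^ 2 * G₂ z.2 u.2 v.2)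
    {G' : E' → E' →L[ℝ] E' →L[ℝ] ℝ} {F : E₁ × E₂ → E'} (hG' : IsMetricAt G' (F (a, b)))
    (hF : ∀ᶠ y in 𝓝 (a, b), ContDiffAt ℝ ∞ F y)
    (hpull : ∀ᶠ y in 𝓝 (a, b), ∀ u v,
      G y u v = G' (F y) (fderiv ℝ F y u) (fderiv ℝ F y v))
    (X : E₁) (Z : E₂) :
    G' (F (a, b)) (coordCurvature G' (F (a, b)) (fderiv ℝ F (a, b) (X, 0))
        (fderiv ℝ F (a, b) (0, Z)) (fderiv ℝ F (a, b) (0, Z))) (fderiv ℝ F (a, b) (X, 0))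
    = - r₁ a * G₂ b Z Z * (fderiv ℝ (fderiv ℝ r₁) a X X - fderiv ℝ r₁ a (christoffel G₁ a X X))
      - r₂ b * G₁ a X X * (fderiv ℝ (fderiv ℝ r₂) b Z Z - fderiv ℝ r₂ b (christoffel G₂ b Z Z))
      - G' (F (a, b)) (coordSecondFundamentalForm G G' F (a, b) (X, 0) (X, 0))
          (coordSecondFundamentalForm G G' F (a, b) (0, Z) (0, Z))
      + G' (F (a, b)) (coordSecondFundamentalForm G G' F (a, b) (X, 0) (0, Z))
          (coordSecondFundamentalForm G G' F (a, b) (X, 0) (0, Z)) := by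
  have hF0 := hF.self_of_nhds
  rw [pullback_curvature hG' hF hpull hG.eventually_contDiffAt,
    apply_pushCovDeriv_pushCovDeriv hG hG' hF0 hpull,
    apply_pushCovDeriv_pushCovDeriv hG hG' hF0 hpull,
    ← warped_curvature hG hG₁ hG₂ hr₁ hr₂ h₁ h₂ h,
    coordSecondFundamentalForm_symm hG hG' hF0 (0, Z) (X, 0),
    hG.christoffel_symm (0, Z) (X, 0),
    hG'.symm.self_of_nhds (coordSecondFundamentalForm G G' F (a, b) (0, Z) (0, Z))]
  ring

end Warped

section ContactCoordinates

variable {E : Type*} [NormedAddCommGroup E] [NormedSpace ℝ E]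

/-- `(φ, ξ, η, G)` is near `y₀` a contact metric structure. -/
structure IsContactMetricAt (G : E → E →L[ℝ] E →L[ℝ] ℝ) (φ : E → E →L[ℝ] E) (ξ : E → E)
    (η : E → E →L[ℝ] ℝ) (y₀ : E) : Prop where
  isMetricAt : IsMetricAt G y₀
  differentiableAt_φ : DifferentiableAt ℝ φ y₀
  differentiableAt_ξ : DifferentiableAt ℝ ξ y₀
  contDiffAt_η : ContDiffAt ℝ ∞ η y₀
  φ_φ : ∀ᶠ y in 𝓝 y₀, ∀ X, φ y (φ y X) = -X + η y X • ξ y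
  η_ξ : ∀ᶠ y in 𝓝 y₀, η y (ξ y) = 1
  η_φ : ∀ᶠ y in 𝓝 y₀, ∀ X, η y (φ y X) = 0
  g_eq : ∀ᶠ y in 𝓝 y₀, ∀ X Y, G y X Y = G y (φ y X) (φ y Y) + η y X * η y Y
  g_φ : ∀ᶠ y in 𝓝 y₀, ∀ X Y, G y X (φ y Y) = - G y (φ y X) Y
  g_ξ : ∀ᶠ y in 𝓝 y₀, ∀ X, G y X (ξ y) = η y X
  dη_eq : ∀ᶠ y in 𝓝 y₀, ∀ X Y,
    (1 / 2 : ℝ) * (fderiv ℝ η y X Y - fderiv ℝ η y Y X) = G y X (φ y Y)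

/-- The Lie derivative of `φ` along `ξ`. -/
def lieEnd (φ : E → E →L[ℝ] E) (ξ : E → E) (y X : E) : E :=
  fderiv ℝ φ y (ξ y) X - fderiv ℝ ξ y (φ y X) + φ y (fderiv ℝ ξ y X)

/-- The Lie derivative of `G` along `ξ`. -/
def lieForm (G : E → E →L[ℝ] E →L[ℝ] ℝ) (ξ : E → E) (y X Y : E) : ℝ :=
  fderiv ℝ G y (ξ y) X Y + G y (fderiv ℝ ξ y X) Y + G y X (fderiv ℝ ξ y Y)

namespace IsContactMetricAt

variable {G : E → E →L[ℝ] E →L[ℝ] ℝ} {φ : E → E →L[ℝ] E} {ξ : E → E}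
    {η : E → E →L[ℝ] ℝ} {y₀ : E}

theorem hasFDerivAt_η (S : IsContactMetricAt G φ ξ η y₀) : HasFDerivAt η (fderiv ℝ η y₀) y₀ :=
  (S.contDiffAt_η.differentiableAt (by simp)).hasFDerivAt

theorem lie_η (S : IsContactMetricAt G φ ξ η y₀) (Y : E) :
    fderiv ℝ η y₀ (ξ y₀) Y + η y₀ (fderiv ℝ ξ y₀ Y) = 0 := by
  have h1 := (S.hasFDerivAt_η.clm_apply S.differentiableAt_ξ.hasFDerivAt).unique
    ((hasFDerivAt_const (1 : ℝ) y₀).congr_of_eventuallyEq S.η_ξ)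
  have h2 := DFunLike.congr_fun h1 Y
  have h3 := S.dη_eq.self_of_nhds (ξ y₀) Y
  rw [S.isMetricAt.symm.self_of_nhds, S.g_ξ.self_of_nhds, S.η_φ.self_of_nhds] at h3
  simp at h2 h3
  linarith

theorem lie_dη (S : IsContactMetricAt G φ ξ η y₀) (X Y : E) :
    lieForm G ξ y₀ X (φ y₀ Y) = - G y₀ X (lieEnd φ ξ y₀ Y) := by
  have hη := S.hasFDerivAt_η
  have hη1 := (S.contDiffAt_η.fderiv_right (m := ∞) (by simp))
  have hη1' := (hη1.differentiableAt (by simp)).hasFDerivAt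
  have hsymm : ∀ a b, fderiv ℝ (fderiv ℝ η) y₀ a b = fderiv ℝ (fderiv ℝ η) y₀ b a :=
    fun a b => (S.contDiffAt_η.isSymmSndFDerivAt (by simp [ENat.LEInfty.out])) a b
  have hξ := S.differentiableAt_ξ.hasFDerivAt
  have hφ := S.differentiableAt_φ.hasFDerivAt
  have hG := S.isMetricAt.differentiableAt.hasFDerivAt
  have hin : ∀ X Y, fderiv ℝ (fderiv ℝ η) y₀ X (ξ y₀) Y - fderiv ℝ (fderiv ℝ η) y₀ X Y (ξ y₀)
      + 2 * G y₀ (fderiv ℝ ξ y₀ X) (φ y₀ Y) = 0 := by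
    intro X Y
    have h1 := ((hη1'.clm_apply hξ).clm_apply (hasFDerivAt_const Y y₀)).sub
      ((hη1'.clm_apply (hasFDerivAt_const Y y₀)).clm_apply hξ)
    have h2 := h1.unique ((hasFDerivAt_const (0 : ℝ) y₀).congr_of_eventuallyEq (by
      filter_upwards [S.dη_eq, S.g_ξ, S.η_φ, S.isMetricAt.symm] with y k1 k2 k3 k4
      have := k1 (ξ y) Y
      rw [k4, k2, k3] at this
      simp at this
      simpa using this))
    have h3 := DFunLike.congr_fun h2 X
    have h4 := S.dη_eq.self_of_nhds (fderiv ℝ ξ y₀ X) Y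
    simp at h3
    linarith
  have hΩ := ((hη1'.clm_apply (hasFDerivAt_const X y₀)).clm_apply (hasFDerivAt_const Y y₀)).sub
    ((hη1'.clm_apply (hasFDerivAt_const Y y₀)).clm_apply (hasFDerivAt_const X y₀))
  have hΩ' := (hG.clm_apply (hasFDerivAt_const X y₀)).clm_apply
    (hφ.clm_apply (hasFDerivAt_const Y y₀))
  have h1 := (hΩ.const_mul (1 / 2 : ℝ)).unique (hΩ'.congr_of_eventuallyEq (by
    filter_upwards [S.dη_eq] with y hy using hy X Y))
  have h2 := DFunLike.congr_fun h1 (ξ y₀)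
  simp at h2
  have h3 := hin X Y
  have h4 := hin Y X
  rw [hsymm X] at h3
  rw [hsymm Y] at h4
  have h5 : fderiv ℝ (fderiv ℝ η) y₀ X Y = fderiv ℝ (fderiv ℝ η) y₀ Y X := hsymm X Y
  rw [h5] at h3
  have h6 : G y₀ (fderiv ℝ ξ y₀ Y) (φ y₀ X) = - G y₀ X (φ y₀ (fderiv ℝ ξ y₀ Y)) := by
    rw [S.g_φ.self_of_nhds, S.isMetricAt.symm.self_of_nhds]
  rw [h6] at h4
  simp only [lieForm, lieEnd, map_add, map_sub]
  linarith

theorem lieForm_symm (S : IsContactMetricAt G φ ξ η y₀) (X Y : E) :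
    lieForm G ξ y₀ X Y = lieForm G ξ y₀ Y X := by
  rw [lieForm, lieForm, S.isMetricAt.fderiv_symm, S.isMetricAt.symm.self_of_nhds _ Y,
    S.isMetricAt.symm.self_of_nhds X]
  ring

theorem lieForm_ξ (S : IsContactMetricAt G φ ξ η y₀) (X : E) : lieForm G ξ y₀ X (ξ y₀) = 0 := by
  have h1 := ((S.isMetricAt.differentiableAt.hasFDerivAt.clm_apply
    (hasFDerivAt_const X y₀)).clm_apply S.differentiableAt_ξ.hasFDerivAt).unique
    ((S.hasFDerivAt_η.clm_apply (hasFDerivAt_const X y₀)).congr_of_eventuallyEq (by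
      filter_upwards [S.g_ξ] with y hy using hy X))
  have h2 := DFunLike.congr_fun h1 (ξ y₀)
  have h3 := S.lie_η X
  simp at h2
  rw [lieForm, S.g_ξ.self_of_nhds]
  linarith

theorem lieForm_add_smul (X Y Z : E) (c : ℝ) :
    lieForm G ξ y₀ X (-Y + c • Z) = - lieForm G ξ y₀ X Y + c * lieForm G ξ y₀ X Z := by
  simp [lieForm]
  ring

theorem lieForm_φ_φ (S : IsContactMetricAt G φ ξ η y₀) (X Y : E) :
    lieForm G ξ y₀ (φ y₀ X) (φ y₀ Y) = - lieForm G ξ y₀ X Y := by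
  have hφ := S.differentiableAt_φ.hasFDerivAt
  have hG := S.isMetricAt.differentiableAt.hasFDerivAt
  have hη := S.hasFDerivAt_η
  have h1 := (hG.clm_apply (hasFDerivAt_const X y₀)).clm_apply (hasFDerivAt_const Y y₀)
  have h2 := ((hG.clm_apply (hφ.clm_apply (hasFDerivAt_const X y₀))).clm_apply
    (hφ.clm_apply (hasFDerivAt_const Y y₀))).add
    ((hη.clm_apply (hasFDerivAt_const X y₀)).mul (hη.clm_apply (hasFDerivAt_const Y y₀)))
  have h3 := h1.unique (h2.congr_of_eventuallyEq (by
      filter_upwards [S.g_eq] with y hy using hy X Y))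
  have h4 := DFunLike.congr_fun h3 (ξ y₀)
  simp at h4
  have k1 := S.lie_η X
  have k2 := S.lie_η Y
  have k3 := S.g_eq.self_of_nhds (fderiv ℝ ξ y₀ X) Y
  have k4 := S.g_eq.self_of_nhds X (fderiv ℝ ξ y₀ Y)
  have k5 := S.lie_dη (φ y₀ X) Y
  have k6 := S.lie_dη (φ y₀ Y) X
  rw [S.lieForm_symm, S.isMetricAt.symm.self_of_nhds] at k6
  have k7 : lieForm G ξ y₀ X Y = lieForm G ξ y₀ (φ y₀ X) (φ y₀ Y)
      + G y₀ (lieEnd φ ξ y₀ X) (φ y₀ Y) + G y₀ (φ y₀ X) (lieEnd φ ξ y₀ Y) := by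
    simp only [lieForm, lieEnd, map_add, map_sub, add_apply, sub_apply]
    linear_combination h4 + k3 + k4 + η y₀ Y * k1 + η y₀ X * k2
  linarith

theorem lieForm_φ_left (S : IsContactMetricAt G φ ξ η y₀) (X Y : E) :
    lieForm G ξ y₀ (φ y₀ X) Y = lieForm G ξ y₀ X (φ y₀ Y) := by
  have h := S.lieForm_φ_φ X (φ y₀ Y)
  rw [S.φ_φ.self_of_nhds, lieForm_add_smul, S.lieForm_ξ] at h
  linarith

theorem lieEnd_symm (S : IsContactMetricAt G φ ξ η y₀) (X Y : E) :
    G y₀ (lieEnd φ ξ y₀ X) Y = G y₀ (lieEnd φ ξ y₀ Y) X := by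
  rw [S.isMetricAt.symm.self_of_nhds, S.isMetricAt.symm.self_of_nhds _ X]
  have h1 := S.lie_dη X Y
  have h2 := S.lie_dη Y X
  rw [← S.lieForm_φ_left, S.lieForm_symm] at h1
  linarith

theorem φ_lieEnd (S : IsContactMetricAt G φ ξ η y₀) (X Y : E) :
    G y₀ (φ y₀ (lieEnd φ ξ y₀ X)) Y = - lieForm G ξ y₀ X Y := by
  have h1 := S.g_φ.self_of_nhds (lieEnd φ ξ y₀ X) Y
  have h2 := S.lie_dη (φ y₀ Y) X
  rw [S.lieForm_φ_φ, S.isMetricAt.symm.self_of_nhds, S.lieForm_symm] at h2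
  linarith

theorem lieForm_eq (S : IsContactMetricAt G φ ξ η y₀) (X Y : E) :
    lieForm G ξ y₀ X Y = fderiv ℝ η y₀ X Y + fderiv ℝ η y₀ Y X
      - 2 * η y₀ (christoffel G y₀ X Y) := by
  have h : ∀ X Y, fderiv ℝ η y₀ X Y = fderiv ℝ G y₀ X Y (ξ y₀) + G y₀ Y (fderiv ℝ ξ y₀ X) := by
    intro X Y
    have h1 := ((S.isMetricAt.differentiableAt.hasFDerivAt.clm_apply
      (hasFDerivAt_const Y y₀)).clm_apply S.differentiableAt_ξ.hasFDerivAt).unique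
      ((S.hasFDerivAt_η.clm_apply (hasFDerivAt_const Y y₀)).congr_of_eventuallyEq (by
        filter_upwards [S.g_ξ] with y hy using hy Y))
    have h2 := DFunLike.congr_fun h1 X
    simp at h2
    linarith
  rw [← S.g_ξ.self_of_nhds, apply_christoffel S.isMetricAt.isInvertible.self_of_nhds, koszul,
    h, h, lieForm, S.isMetricAt.symm.self_of_nhds _ Y]
  ring

variable {E₀ : Type*} [NormedAddCommGroup E₀] [NormedSpace ℝ E₀] {F : E₀ → E} {x₀ : E₀}

theorem fderiv_η_eq (S : IsContactMetricAt G φ ξ η (F x₀)) (hF : ContDiffAt ℝ ∞ F x₀)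
    (hη : ∀ᶠ x in 𝓝 x₀, ∀ u, η (F x) (fderiv ℝ F x u) = 0) (u v : E₀) :
    fderiv ℝ η (F x₀) (fderiv ℝ F x₀ u) (fderiv ℝ F x₀ v)
      = - η (F x₀) (fderiv ℝ (fderiv ℝ F) x₀ u v) := by
  have hF1 := ((hF.fderiv_right (m := ∞) (by simp)).differentiableAt (by simp)).hasFDerivAt
  have hF' := (hF.differentiableAt (by simp)).hasFDerivAt
  have hηF : HasFDerivAt (fun x => η (F x)) ((fderiv ℝ η (F x₀)).comp (fderiv ℝ F x₀)) x₀ :=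
    HasFDerivAt.comp (g := η) x₀ S.hasFDerivAt_η hF'
  have h1 := (hηF.clm_apply (hF1.clm_apply (hasFDerivAt_const v x₀))).unique
    ((hasFDerivAt_const (0 : ℝ) x₀).congr_of_eventuallyEq (by
      filter_upwards [hη] with x hx using hx v))
  have h2 := DFunLike.congr_fun h1 u
  simp at h2
  linarith

theorem apply_φ_eq_zero (S : IsContactMetricAt G φ ξ η (F x₀)) (hF : ContDiffAt ℝ ∞ F x₀)
    (hη : ∀ᶠ x in 𝓝 x₀, ∀ u, η (F x) (fderiv ℝ F x u) = 0) (u v : E₀) :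
    G (F x₀) (fderiv ℝ F x₀ u) (φ (F x₀) (fderiv ℝ F x₀ v)) = 0 := by
  have hsymm : fderiv ℝ (fderiv ℝ F) x₀ u v = fderiv ℝ (fderiv ℝ F) x₀ v u :=
    (hF.isSymmSndFDerivAt (by simp [ENat.LEInfty.out])) u v
  rw [← S.dη_eq.self_of_nhds, S.fderiv_η_eq hF hη, S.fderiv_η_eq hF hη, hsymm, sub_self, mul_zero]

theorem apply_coordSecondFundamentalForm_ξ (S : IsContactMetricAt G φ ξ η (F x₀))
    (hF : ContDiffAt ℝ ∞ F x₀)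
    (hη : ∀ᶠ x in 𝓝 x₀, ∀ u, η (F x) (fderiv ℝ F x u) = 0)
    (G₀ : E₀ → E₀ →L[ℝ] E₀ →L[ℝ] ℝ) (u v : E₀) :
    G (F x₀) (coordSecondFundamentalForm G₀ G F x₀ u v) (ξ (F x₀))
      = G (F x₀) (φ (F x₀) ((1 / 2 : ℝ) • lieEnd φ ξ (F x₀) (fderiv ℝ F x₀ u)))
          (fderiv ℝ F x₀ v) := by
  have hsymm : fderiv ℝ (fderiv ℝ F) x₀ u v = fderiv ℝ (fderiv ℝ F) x₀ v u :=
    (hF.isSymmSndFDerivAt (by simp [ENat.LEInfty.out])) u v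
  rw [S.g_ξ.self_of_nhds, coordSecondFundamentalForm, map_sub, hη.self_of_nhds, pushCovDeriv,
    map_add, map_smul, map_smul, smul_apply, S.φ_lieEnd, S.lieForm_eq, S.fderiv_η_eq hF hη,
    S.fderiv_η_eq hF hη, hsymm]
  simp
  ring

end IsContactMetricAt

end ContactCoordinates

section Charts

variable {E : Type*} [NormedAddCommGroup E] [NormedSpace ℝ E]
  {H : Type*} [TopologicalSpace H] {I : ModelWithCorners ℝ E H} [I.Boundaryless]
  {M : Type*} [TopologicalSpace M] [ChartedSpace H M] [IsManifold I ∞ M]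

theorem symm_mem_chartAt_source {p : M} {y : E} (hy : y ∈ (extChartAt I p).target) :
    (extChartAt I p).symm y ∈ (chartAt H p).source := by
  rw [← extChartAt_source I]
  exact (extChartAt I p).map_target hy

theorem contMDiffAt_extChartAt_symm {p : M} {y : E} (hy : y ∈ (extChartAt I p).target) :
    ContMDiffAt 𝓘(ℝ, E) I ∞ (extChartAt I p).symm y :=
  (contMDiffOn_extChartAt_symm p).contMDiffAt ((isOpen_extChartAt_target p).mem_nhds hy)

theorem chartDeriv_chartSymmDeriv {p : M} {y : E} (hy : y ∈ (extChartAt I p).target) (u : E) :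
    chartDeriv I p y (chartSymmDeriv I p y u) = u := by
  have := mfderiv_extChartAt_comp_mfderivWithin_extChartAt_symm (I := I) hy
  rw [I.range_eq_univ, mfderivWithin_univ] at this
  exact DFunLike.congr_fun this u

theorem chartSymmDeriv_chartDeriv {p : M} {y : E} (hy : y ∈ (extChartAt I p).target)
    (u : TangentSpace I ((extChartAt I p).symm y)) :
    chartSymmDeriv I p y (chartDeriv I p y u) = u := by
  have := mfderivWithin_extChartAt_symm_comp_mfderiv_extChartAt (I := I) hy
  rw [I.range_eq_univ, mfderivWithin_univ] at this
  exact DFunLike.congr_fun this u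

theorem chartSymmDeriv_self (p : M) (u : E) :
    (chartSymmDeriv I p (extChartAt I p p) u : E) = u := by
  have := mfderivWithin_range_extChartAt_symm (I := I) (x := p)
  rw [I.range_eq_univ, mfderivWithin_univ] at this
  exact DFunLike.congr_fun this u

theorem chartDeriv_self (p : M) (u : E) :
    chartDeriv I p (extChartAt I p p) u = u := by
  have h := chartDeriv_chartSymmDeriv (I := I) (mem_extChartAt_target p) u
  have h2 := chartSymmDeriv_self (I := I) p u
  exact (congrArg (fun w : E => chartDeriv I p (extChartAt I p p) w) h2.symm).trans h

/-- A vector field along the inverse of a chart is smooth if it is so in coordinates. -/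
theorem contMDiffAt_along_symm_iff {p : M} {y : E} (hy : y ∈ (extChartAt I p).target)
    (V : ∀ z : E, TangentSpace I ((extChartAt I p).symm z)) :
    ContMDiffAt 𝓘(ℝ, E) (I.prod 𝓘(ℝ, E)) ∞
      (fun z => TotalSpace.mk' E (E := fun x : M => TangentSpace I x)
        ((extChartAt I p).symm z) (V z)) y ↔
    ContDiffAt ℝ ∞ (fun z => chartDeriv I p z (V z)) y := by
  have hs : ∀ z ∈ (extChartAt I p).target, (extChartAt I p).symm z ∈
      (trivializationAt E (TangentSpace I) p).baseSet := by
    intro z hz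
    rw [TangentBundle.trivializationAt_baseSet]
    exact symm_mem_chartAt_source hz
  rw [(trivializationAt E (TangentSpace I) p).contMDiffAt_iff
    ((trivializationAt E (TangentSpace I) p).mem_source.2 (hs y hy)), ← contMDiffAt_iff_contDiffAt]
  have h : (fun z => chartDeriv I p z (V z)) =ᶠ[𝓝 y] (fun z =>
      (trivializationAt E (TangentSpace I) p (TotalSpace.mk' E (E := fun x : M => TangentSpace I x)
        ((extChartAt I p).symm z) (V z))).2) := by
    filter_upwards [(isOpen_extChartAt_target p).mem_nhds hy] with z hz
    have h1 := TangentBundle.continuousLinearMapAt_trivializationAt (I := I)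
      (symm_mem_chartAt_source hz)
    rw [chartDeriv, ← h1]
    exact Bundle.Trivialization.continuousLinearMapAt_apply_of_mem (R := ℝ)
      (trivializationAt E (TangentSpace I) p) (hs z hz) (V z)
  rw [h.contMDiffAt_iff]
  exact and_iff_right (contMDiffAt_extChartAt_symm hy)

theorem contMDiffAt_chartSymmDeriv {p : M} {y : E} (hy : y ∈ (extChartAt I p).target) (u : E) :
    ContMDiffAt 𝓘(ℝ, E) (I.prod 𝓘(ℝ, E)) ∞
      (fun z => TotalSpace.mk' E (E := fun x : M => TangentSpace I x)
        ((extChartAt I p).symm z) (chartSymmDeriv I p z u)) y := by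
  rw [contMDiffAt_along_symm_iff hy]
  refine (contDiffAt_const (c := u)).congr_of_eventuallyEq ?_
  filter_upwards [(isOpen_extChartAt_target p).mem_nhds hy] with z hz
  exact chartDeriv_chartSymmDeriv hz u

theorem contDiffAt_covector_along_symm {p : M} {y : E} (hy : y ∈ (extChartAt I p).target)
    {f : ∀ x : M, TangentSpace I x →L[ℝ] ℝ}
    (hf : ContMDiff I (I.prod 𝓘(ℝ, E →L[ℝ] ℝ)) ∞
    (fun x => TotalSpace.mk' (E →L[ℝ] ℝ)
      (E := fun x : M => TangentSpace I x →L[ℝ] Trivial M ℝ x) x (f x))) (u : E) :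
    ContDiffAt ℝ ∞ (fun z => f ((extChartAt I p).symm z) (chartSymmDeriv I p z u)) y := by
  have h := ContMDiffAt.clm_bundle_apply (F₁ := E) (F₂ := ℝ)
    (E₁ := fun x : M => TangentSpace I x) (E₂ := Trivial M ℝ)
    (hf.contMDiffAt.comp y (contMDiffAt_extChartAt_symm hy)) (contMDiffAt_chartSymmDeriv hy u)
  rw [contMDiffAt_totalSpace] at h
  exact h.2.contDiffAt

theorem contDiffAt_metricInChart_apply [FiniteDimensional ℝ E] {p : M} {y : E}
    (hy : y ∈ (extChartAt I p).target)
    (g : ContMDiffRiemannianMetric I ∞ E (fun x : M => TangentSpace I x)) (u v : E) :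
    ContDiffAt ℝ ∞ (fun z => metricInChart I g.inner p z u v) y := by
  have h := ContMDiffAt.clm_bundle_apply₂ (F₁ := E) (F₂ := E) (F₃ := ℝ)
    (E₁ := fun x : M => TangentSpace I x) (E₂ := fun x : M => TangentSpace I x)
    (E₃ := Trivial M ℝ)
    (g.contMDiff.contMDiffAt.comp y (contMDiffAt_extChartAt_symm hy))
    (contMDiffAt_chartSymmDeriv hy u) (contMDiffAt_chartSymmDeriv hy v)
  rw [contMDiffAt_totalSpace] at h
  exact h.2.contDiffAt

theorem metricInChart_apply (g : ∀ x : M, TangentSpace I x →L[ℝ] TangentSpace I x →L[ℝ] ℝ)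
    (p : M) (y u v : E) : metricInChart I g p y u v =
      g ((extChartAt I p).symm y) (chartSymmDeriv I p y u) (chartSymmDeriv I p y v) := rfl

theorem chartSymmDeriv_ne_zero {p : M} {y : E} (hy : y ∈ (extChartAt I p).target) {u : E}
    (hu : u ≠ 0) : chartSymmDeriv I p y u ≠ 0 := by
  intro h
  apply hu
  rw [← chartDeriv_chartSymmDeriv hy u, h, map_zero]

theorem isMetricAt_of_pos [FiniteDimensional ℝ E] {G : E → E →L[ℝ] E →L[ℝ] ℝ} {y₀ : E}
    (h1 : ∀ᶠ y in 𝓝 y₀, ∀ u v, ContDiffAt ℝ ∞ (fun z => G z u v) y)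
    (h2 : ∀ᶠ y in 𝓝 y₀, ∀ u v, G y u v = G y v u)
    (h3 : ∀ᶠ y in 𝓝 y₀, ∀ u, u ≠ 0 → 0 < G y u u) : IsMetricAt G y₀ where
  eventually_contDiffAt := by
    filter_upwards [h1] with y hy
    exact contDiffAt_clm_iff.2 fun u => contDiffAt_clm_iff.2 fun v => hy u v
  symm := h2
  isInvertible := by
    filter_upwards [h3] with y hy using isInvertible_of_pos hy

theorem isMetricAt_metricInChart [FiniteDimensional ℝ E] {p : M} {y : E}
    (hy : y ∈ (extChartAt I p).target)
    (g : ContMDiffRiemannianMetric I ∞ E (fun x : M => TangentSpace I x)) :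
    IsMetricAt (metricInChart I g.inner p) y := by
  have hn := (isOpen_extChartAt_target (I := I) p).mem_nhds hy
  refine isMetricAt_of_pos ?_ ?_ ?_
  · filter_upwards [hn] with z hz u v using contDiffAt_metricInChart_apply hz g u v
  · filter_upwards with z u v
    rw [metricInChart_apply, metricInChart_apply, g.symm]
  · filter_upwards [hn] with z hz u hu
    exact g.pos _ _ (chartSymmDeriv_ne_zero hz hu)

theorem covector_congr (f : ∀ x : M, TangentSpace I x →L[ℝ] ℝ) {x y : M}
    (h : x = y) : (f x : E →L[ℝ] ℝ) = f y := by
  subst h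
  rfl

theorem metric_congr (g : ∀ x : M, TangentSpace I x →L[ℝ] TangentSpace I x →L[ℝ] ℝ) {x y : M}
    (h : x = y) : (g x : E →L[ℝ] E →L[ℝ] ℝ) = g y := by
  subst h
  rfl

theorem metricInChart_self (g : ∀ x : M, TangentSpace I x →L[ℝ] TangentSpace I x →L[ℝ] ℝ)
    (p : M) (u v : E) : metricInChart I g p (extChartAt I p p) u v = g p u v := by
  have h : (extChartAt I p).symm (extChartAt I p p) = p := extChartAt_to_inv p
  have h1 : metricInChart I g p (extChartAt I p p) u v =
      (g ((extChartAt I p).symm (extChartAt I p p)) : E →L[ℝ] E →L[ℝ] ℝ)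
      (chartSymmDeriv I p (extChartAt I p p) u : E)
      (chartSymmDeriv I p (extChartAt I p p) v : E) := rfl
  rw [h1, chartSymmDeriv_self, chartSymmDeriv_self, metric_congr g h]
  rfl

end Charts

section Maps

variable {E : Type*} [NormedAddCommGroup E] [NormedSpace ℝ E]
  {H : Type*} [TopologicalSpace H] {I : ModelWithCorners ℝ E H} [I.Boundaryless]
  {M : Type*} [TopologicalSpace M] [ChartedSpace H M] [IsManifold I ∞ M]
  {E' : Type*} [NormedAddCommGroup E'] [NormedSpace ℝ E']
  {H' : Type*} [TopologicalSpace H'] {I' : ModelWithCorners ℝ E' H'} [I'.Boundaryless]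
  {N : Type*} [TopologicalSpace N] [ChartedSpace H' N] [IsManifold I' ∞ N]

/-- A map between manifolds in the preferred charts at two given points. -/
def mapInCharts (I : ModelWithCorners ℝ E H) (I' : ModelWithCorners ℝ E' H') (f : M → N)
    (p : M) (q : N) : E → E' :=
  extChartAt I' q ∘ f ∘ (extChartAt I p).symm

theorem eventually_mem_target_map {f : M → N} (hf : ContMDiff I I' ∞ f) {p : M} {q : N} {y₀ : E}
    (hy : y₀ ∈ (extChartAt I p).target)
    (hy' : f ((extChartAt I p).symm y₀) ∈ (extChartAt I' q).source) :
    ∀ᶠ y in 𝓝 y₀, y ∈ (extChartAt I p).target ∧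
      f ((extChartAt I p).symm y) ∈ (extChartAt I' q).source := by
  have h1 : ContinuousAt (f ∘ (extChartAt I p).symm) y₀ :=
    hf.continuous.continuousAt.comp (contMDiffAt_extChartAt_symm hy).continuousAt
  filter_upwards [(isOpen_extChartAt_target (I := I) p).mem_nhds hy,
    h1.preimage_mem_nhds ((isOpen_extChartAt_source q).mem_nhds hy')] with y a b
    using ⟨a, b⟩

theorem contDiffAt_mapInCharts {f : M → N} (hf : ContMDiff I I' ∞ f) {p : M} {q : N} {y : E}
    (hy : y ∈ (extChartAt I p).target)
    (hy' : f ((extChartAt I p).symm y) ∈ (extChartAt I' q).source) :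
    ContDiffAt ℝ ∞ (mapInCharts I I' f p q) y := by
  rw [← contMDiffAt_iff_contDiffAt]
  refine ContMDiffAt.comp y ?_ (ContMDiffAt.comp y hf.contMDiffAt (contMDiffAt_extChartAt_symm hy))
  apply contMDiffAt_extChartAt'
  rwa [← extChartAt_source I']

theorem fderiv_mapInCharts {f : M → N} (hf : ContMDiff I I' ∞ f) {p : M} {q : N} {y : E}
    (hy : y ∈ (extChartAt I p).target)
    (hy' : f ((extChartAt I p).symm y) ∈ (extChartAt I' q).source) (u : E) :
    (chartSymmDeriv I' q (mapInCharts I I' f p q y)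
      (fderiv ℝ (mapInCharts I I' f p q) y u) : E') =
    mfderiv I I' f ((extChartAt I p).symm y) (chartSymmDeriv I p y u) := by
  have hF := contDiffAt_mapInCharts hf hy hy'
  have hF1 := ((hF.differentiableAt (by simp)).hasFDerivAt).hasMFDerivAt
  have ht : mapInCharts I I' f p q y ∈ (extChartAt I' q).target :=
    (extChartAt I' q).map_source hy'
  have h1 := ((contMDiffAt_extChartAt_symm ht).mdifferentiableAt (by simp)).hasMFDerivAt.comp y hF1
  have h2 := (hf.contMDiffAt.mdifferentiableAt
    (x := (extChartAt I p).symm y) (by simp)).hasMFDerivAt.comp y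
    ((contMDiffAt_extChartAt_symm hy).mdifferentiableAt (by simp)).hasMFDerivAt
  have h3 : (extChartAt I' q).symm ∘ mapInCharts I I' f p q =ᶠ[𝓝 y]
      f ∘ (extChartAt I p).symm := by
    filter_upwards [eventually_mem_target_map hf hy hy'] with z hz
    exact (extChartAt I' q).left_inv hz.2
  have h4 := hasMFDerivAt_unique (h1.congr_of_eventuallyEq h3.symm) h2
  exact DFunLike.congr_fun h4 u

theorem mfderiv_eq_fderiv_mapInCharts {f : M → N} (hf : ContMDiff I I' ∞ f) (p : M)
    (u : E) : (mfderiv I I' f p u : E') =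
      fderiv ℝ (mapInCharts I I' f p (f p)) (extChartAt I p p) u := by
  have h := (hf.contMDiffAt.mdifferentiableAt (x := p) (by simp)).hasMFDerivAt.2
  rw [I.range_eq_univ] at h
  let f' : E →L[ℝ] E' := mfderiv I I' f p
  have h2 : HasFDerivWithinAt (mapInCharts I I' f p (f p)) f' Set.univ (extChartAt I p p) := h
  exact DFunLike.congr_fun (hasFDerivWithinAt_univ.1 h2).fderiv.symm u

end Maps

section ProductChart

variable {E₁ : Type*} [NormedAddCommGroup E₁] [NormedSpace ℝ E₁]
  {H₁ : Type*} [TopologicalSpace H₁] {I₁ : ModelWithCorners ℝ E₁ H₁} [I₁.Boundaryless]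
  {M₁ : Type*} [TopologicalSpace M₁] [ChartedSpace H₁ M₁] [IsManifold I₁ ∞ M₁]
  {E₂ : Type*} [NormedAddCommGroup E₂] [NormedSpace ℝ E₂]
  {H₂ : Type*} [TopologicalSpace H₂] {I₂ : ModelWithCorners ℝ E₂ H₂} [I₂.Boundaryless]
  {M₂ : Type*} [TopologicalSpace M₂] [ChartedSpace H₂ M₂] [IsManifold I₂ ∞ M₂]

theorem mfderiv_fst_chartSymmDeriv {p : M₁ × M₂} {y : E₁ × E₂}
    (h₁ : y.1 ∈ (extChartAt I₁ p.1).target) (h₂ : y.2 ∈ (extChartAt I₂ p.2).target)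
    (u : E₁ × E₂) :
    (mfderiv (I₁.prod I₂) I₁ (Prod.fst : M₁ × M₂ → M₁) ((extChartAt (I₁.prod I₂) p).symm y)
      (chartSymmDeriv (I₁.prod I₂) p y u) : E₁) = chartSymmDeriv I₁ p.1 y.1 u.1 := by
  have hy : y ∈ (extChartAt (I₁.prod I₂) p).target := by
    rw [extChartAt_prod]
    exact ⟨h₁, h₂⟩
  have k1 := (mdifferentiableAt_fst (I := I₁) (I' := I₂)
    (x := (extChartAt (I₁.prod I₂) p).symm y)).hasMFDerivAt.comp y
    ((contMDiffAt_extChartAt_symm hy).mdifferentiableAt (by simp)).hasMFDerivAt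
  have k2 := ((contMDiffAt_extChartAt_symm h₁).mdifferentiableAt (by simp)).hasMFDerivAt.comp y
    (hasFDerivAt_fst (𝕜 := ℝ) (p := y)).hasMFDerivAt
  have k3 := hasMFDerivAt_unique k1 (k2.congr_of_eventuallyEq (f₁ := Prod.fst ∘
    (extChartAt (I₁.prod I₂) p).symm) (by rw [extChartAt_prod]; rfl))
  exact DFunLike.congr_fun k3 u

theorem mfderiv_snd_chartSymmDeriv {p : M₁ × M₂} {y : E₁ × E₂}
    (h₁ : y.1 ∈ (extChartAt I₁ p.1).target) (h₂ : y.2 ∈ (extChartAt I₂ p.2).target)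
    (u : E₁ × E₂) :
    (mfderiv (I₁.prod I₂) I₂ (Prod.snd : M₁ × M₂ → M₂) ((extChartAt (I₁.prod I₂) p).symm y)
      (chartSymmDeriv (I₁.prod I₂) p y u) : E₂) = chartSymmDeriv I₂ p.2 y.2 u.2 := by
  have hy : y ∈ (extChartAt (I₁.prod I₂) p).target := by
    rw [extChartAt_prod]
    exact ⟨h₁, h₂⟩
  have k1 := (mdifferentiableAt_snd (I := I₁) (I' := I₂)
    (x := (extChartAt (I₁.prod I₂) p).symm y)).hasMFDerivAt.comp y
    ((contMDiffAt_extChartAt_symm hy).mdifferentiableAt (by simp)).hasMFDerivAt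
  have k2 := ((contMDiffAt_extChartAt_symm h₂).mdifferentiableAt (by simp)).hasMFDerivAt.comp y
    (hasFDerivAt_snd (𝕜 := ℝ) (p := y)).hasMFDerivAt
  have k3 := hasMFDerivAt_unique k1 (k2.congr_of_eventuallyEq (f₁ := Prod.snd ∘
    (extChartAt (I₁.prod I₂) p).symm) (by rw [extChartAt_prod]; rfl))
  exact DFunLike.congr_fun k3 u

theorem metricInChart_doublyWarpedMetric
    (g₁ : ∀ x : M₁, TangentSpace I₁ x →L[ℝ] TangentSpace I₁ x →L[ℝ] ℝ)
    (g₂ : ∀ x : M₂, TangentSpace I₂ x →L[ℝ] TangentSpace I₂ x →L[ℝ] ℝ)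
    (ρ₁ : M₁ → ℝ) (ρ₂ : M₂ → ℝ) {p : M₁ × M₂} {y : E₁ × E₂}
    (h₁ : y.1 ∈ (extChartAt I₁ p.1).target) (h₂ : y.2 ∈ (extChartAt I₂ p.2).target)
    (u v : E₁ × E₂) :
    metricInChart (I₁.prod I₂) (doublyWarpedMetric I₁ I₂ g₁ g₂ ρ₁ ρ₂) p y u v =
      (ρ₂ ∘ (extChartAt I₂ p.2).symm) y.2 ^ 2 * metricInChart I₁ g₁ p.1 y.1 u.1 v.1
      + (ρ₁ ∘ (extChartAt I₁ p.1).symm) y.1 ^ 2 * metricInChart I₂ g₂ p.2 y.2 u.2 v.2 := by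
  have hq1 : ((extChartAt (I₁.prod I₂) p).symm y).1 = (extChartAt I₁ p.1).symm y.1 := by
    rw [extChartAt_prod]; rfl
  have hq2 : ((extChartAt (I₁.prod I₂) p).symm y).2 = (extChartAt I₂ p.2).symm y.2 := by
    rw [extChartAt_prod]; rfl
  have e : metricInChart (I₁.prod I₂) (doublyWarpedMetric I₁ I₂ g₁ g₂ ρ₁ ρ₂) p y u v =
      ρ₂ ((extChartAt (I₁.prod I₂) p).symm y).2 ^ 2 *
        (g₁ ((extChartAt (I₁.prod I₂) p).symm y).1 : E₁ →L[ℝ] E₁ →L[ℝ] ℝ)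
        (mfderiv (I₁.prod I₂) I₁ (Prod.fst : M₁ × M₂ → M₁) ((extChartAt (I₁.prod I₂) p).symm y)
          (chartSymmDeriv (I₁.prod I₂) p y u) : E₁)
        (mfderiv (I₁.prod I₂) I₁ (Prod.fst : M₁ × M₂ → M₁) ((extChartAt (I₁.prod I₂) p).symm y)
          (chartSymmDeriv (I₁.prod I₂) p y v) : E₁)
      + ρ₁ ((extChartAt (I₁.prod I₂) p).symm y).1 ^ 2 *
        (g₂ ((extChartAt (I₁.prod I₂) p).symm y).2 : E₂ →L[ℝ] E₂ →L[ℝ] ℝ)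
        (mfderiv (I₁.prod I₂) I₂ (Prod.snd : M₁ × M₂ → M₂) ((extChartAt (I₁.prod I₂) p).symm y)
          (chartSymmDeriv (I₁.prod I₂) p y u) : E₂)
        (mfderiv (I₁.prod I₂) I₂ (Prod.snd : M₁ × M₂ → M₂) ((extChartAt (I₁.prod I₂) p).symm y)
          (chartSymmDeriv (I₁.prod I₂) p y v) : E₂) := rfl
  rw [e, mfderiv_fst_chartSymmDeriv h₁ h₂, mfderiv_fst_chartSymmDeriv h₁ h₂,
    mfderiv_snd_chartSymmDeriv h₁ h₂, mfderiv_snd_chartSymmDeriv h₁ h₂, metric_congr g₁ hq1,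
    metric_congr g₂ hq2, hq1, hq2]
  rfl

end ProductChart

namespace AlmostContactMetricStructure

variable {E : Type*} [NormedAddCommGroup E] [NormedSpace ℝ E] [FiniteDimensional ℝ E]
  {H : Type*} [TopologicalSpace H] {I : ModelWithCorners ℝ E H} [I.Boundaryless]
  {M : Type*} [TopologicalSpace M] [ChartedSpace H M] [IsManifold I ∞ M]
  (S : AlmostContactMetricStructure I M) {p : M} {y : E}

theorem contDiffAt_ξInChart (hy : y ∈ (extChartAt I p).target) :
    ContDiffAt ℝ ∞ (S.ξInChart p) y :=
  (contMDiffAt_along_symm_iff hy fun z => S.ξ ((extChartAt I p).symm z)).1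
    (S.contMDiff_ξ.contMDiffAt.comp y (contMDiffAt_extChartAt_symm hy))

theorem contDiffAt_ηInChart (hy : y ∈ (extChartAt I p).target) :
    ContDiffAt ℝ ∞ (S.ηInChart p) y :=
  contDiffAt_clm_iff.2 fun u => contDiffAt_covector_along_symm hy S.contMDiff_η u

theorem contDiffAt_φInChart (hy : y ∈ (extChartAt I p).target) :
    ContDiffAt ℝ ∞ (S.φInChart p) y := by
  refine contDiffAt_clm_iff.2 fun u => ?_
  have h := ContMDiffAt.clm_bundle_apply (F₁ := E) (F₂ := E)
    (E₁ := fun x : M => TangentSpace I x) (E₂ := fun x : M => TangentSpace I x)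
    (S.contMDiff_φ.contMDiffAt.comp y (contMDiffAt_extChartAt_symm hy))
    (contMDiffAt_chartSymmDeriv hy u)
  exact (contMDiffAt_along_symm_iff hy fun z => S.φ ((extChartAt I p).symm z)
    (chartSymmDeriv I p z u)).1 h

theorem chartSymmDeriv_φInChart (hy : y ∈ (extChartAt I p).target) (X : E) :
    chartSymmDeriv I p y (S.φInChart p y X) =
      S.φ ((extChartAt I p).symm y) (chartSymmDeriv I p y X) :=
  chartSymmDeriv_chartDeriv hy _

theorem chartSymmDeriv_ξInChart (hy : y ∈ (extChartAt I p).target) :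
    chartSymmDeriv I p y (S.ξInChart p y) = S.ξ ((extChartAt I p).symm y) :=
  chartSymmDeriv_chartDeriv hy _

theorem ηInChart_apply (X : E) : S.ηInChart p y X =
    S.η ((extChartAt I p).symm y) (chartSymmDeriv I p y X) := rfl

theorem dη_inChart (hy : y ∈ (extChartAt I p).target) (X Y : E) :
    (1 / 2 : ℝ) * (fderiv ℝ (S.ηInChart p) y X Y - fderiv ℝ (S.ηInChart p) y Y X) =
      S.dη ((extChartAt I p).symm y) (chartSymmDeriv I p y X) (chartSymmDeriv I p y Y) := by
  set q := (extChartAt I p).symm y with hq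
  have hid : ContMDiff I I ∞ (id : M → M) := contMDiff_id
  have hy' : id ((extChartAt I p).symm y) ∈ (extChartAt I q).source := mem_extChartAt_source q
  set τ := mapInCharts I I id p q with hτ
  have hτy : τ y = extChartAt I q q := rfl
  have hmem := eventually_mem_target_map hid hy hy'
  have hder : ∀ᶠ z in 𝓝 y, ∀ u, (chartSymmDeriv I q (τ z) (fderiv ℝ τ z u) : E) =
      chartSymmDeriv I p z u := by
    filter_upwards [hmem] with z hz u
    refine (fderiv_mapInCharts hid hz.1 hz.2 u).trans ?_
    rw [mfderiv_id]
    rfl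
  have hev : ∀ᶠ z in 𝓝 y, ∀ u, S.ηInChart p z u = S.ηInChart q (τ z) (fderiv ℝ τ z u) := by
    filter_upwards [hmem, hder] with z hz hz' u
    have k : (extChartAt I q).symm (τ z) = (extChartAt I p).symm z :=
      (extChartAt I q).left_inv hz.2
    have e1 : S.ηInChart q (τ z) (fderiv ℝ τ z u) =
        (S.η ((extChartAt I q).symm (τ z)) : E →L[ℝ] ℝ)
        (chartSymmDeriv I q (τ z) (fderiv ℝ τ z u) : E) := rfl
    rw [e1, hz', covector_congr S.η k]
    rfl
  have hτd : ContDiffAt ℝ ∞ τ y := contDiffAt_mapInCharts hid hy hy'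
  have hτ1 : HasFDerivAt τ (fderiv ℝ τ y) y := (hτd.differentiableAt (by simp)).hasFDerivAt
  have hτ2 : HasFDerivAt (fderiv ℝ τ) (fderiv ℝ (fderiv ℝ τ) y) y :=
    ((hτd.fderiv_right (m := ∞) (by simp)).differentiableAt (by simp)).hasFDerivAt
  have hsymm : ∀ a b, fderiv ℝ (fderiv ℝ τ) y a b = fderiv ℝ (fderiv ℝ τ) y b a :=
    fun a b => (hτd.isSymmSndFDerivAt (by simp [ENat.LEInfty.out])) a b
  have hηp := ((S.contDiffAt_ηInChart hy).differentiableAt (by simp)).hasFDerivAt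
  have hηq : HasFDerivAt (S.ηInChart q) (fderiv ℝ (S.ηInChart q) (τ y)) (τ y) :=
    ((S.contDiffAt_ηInChart (mem_extChartAt_target q)).differentiableAt (by simp)).hasFDerivAt
  have hητ : HasFDerivAt (fun z => S.ηInChart q (τ z))
      ((fderiv ℝ (S.ηInChart q) (τ y)).comp (fderiv ℝ τ y)) y :=
    HasFDerivAt.comp (g := S.ηInChart q) y hηq hτ1
  have key : ∀ X Y, fderiv ℝ (S.ηInChart p) y X Y =
      fderiv ℝ (S.ηInChart q) (τ y) (fderiv ℝ τ y X) (fderiv ℝ τ y Y)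
      + S.ηInChart q (τ y) (fderiv ℝ (fderiv ℝ τ) y X Y) := by
    intro X Y
    have h1 := (hηp.clm_apply (hasFDerivAt_const Y y)).unique
      ((hητ.clm_apply (hτ2.clm_apply (hasFDerivAt_const Y y))).congr_of_eventuallyEq (by
        filter_upwards [hev] with z hz using hz Y))
    have h2 := DFunLike.congr_fun h1 X
    simp at h2
    rw [h2]
    ring
  have hτX : ∀ X, fderiv ℝ τ y X = chartSymmDeriv I p y X := by
    intro X
    have h1 := hder.self_of_nhds X
    rw [hτy] at h1
    rw [chartSymmDeriv_self] at h1
    exact h1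
  rw [key, key, hsymm Y X, hτX, hτX, dη, ← hτy]
  ring

theorem isContactMetricAt_inChart (hS : S.IsContactMetric) (hy : y ∈ (extChartAt I p).target) :
    IsContactMetricAt (metricInChart I S.g.inner p) (S.φInChart p) (S.ξInChart p) (S.ηInChart p)
      y where
  isMetricAt := isMetricAt_metricInChart hy S.g
  differentiableAt_φ := (S.contDiffAt_φInChart hy).differentiableAt (by simp)
  differentiableAt_ξ := (S.contDiffAt_ξInChart hy).differentiableAt (by simp)
  contDiffAt_η := S.contDiffAt_ηInChart hy
  φ_φ := by
    filter_upwards [(isOpen_extChartAt_target (I := I) p).mem_nhds hy] with z hz X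
    have h1 : S.φInChart p z (S.φInChart p z X) = chartDeriv I p z
        (S.φ _ (chartSymmDeriv I p z (S.φInChart p z X))) := rfl
    rw [h1, chartSymmDeriv_φInChart S hz, S.φ_φ, map_add, map_neg, map_smul,
      chartDeriv_chartSymmDeriv hz]
    rfl
  η_ξ := by
    filter_upwards [(isOpen_extChartAt_target (I := I) p).mem_nhds hy] with z hz
    rw [ηInChart_apply, chartSymmDeriv_ξInChart S hz, S.η_ξ]
  η_φ := by
    filter_upwards [(isOpen_extChartAt_target (I := I) p).mem_nhds hy] with z hz X
    rw [ηInChart_apply, chartSymmDeriv_φInChart S hz, S.η_φ]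
  g_eq := by
    filter_upwards [(isOpen_extChartAt_target (I := I) p).mem_nhds hy] with z hz X Y
    rw [metricInChart_apply, metricInChart_apply, chartSymmDeriv_φInChart S hz,
      chartSymmDeriv_φInChart S hz, S.g_eq]
    rfl
  g_φ := by
    filter_upwards [(isOpen_extChartAt_target (I := I) p).mem_nhds hy] with z hz X Y
    rw [metricInChart_apply, metricInChart_apply, chartSymmDeriv_φInChart S hz,
      chartSymmDeriv_φInChart S hz, S.g_φ]
  g_ξ := by
    filter_upwards [(isOpen_extChartAt_target (I := I) p).mem_nhds hy] with z hz X
    rw [metricInChart_apply, chartSymmDeriv_ξInChart S hz, S.g_ξ]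
    rfl
  dη_eq := by
    filter_upwards [(isOpen_extChartAt_target (I := I) p).mem_nhds hy] with z hz X Y
    rw [dη_inChart S hz, hS, metricInChart_apply, chartSymmDeriv_φInChart S hz]

theorem φInChart_self (X : E) : S.φInChart p (extChartAt I p p) X = S.φ p X := by
  have h : (extChartAt I p).symm (extChartAt I p p) = p := extChartAt_to_inv p
  have h1 : ∀ {a b : M}, a = b → (S.φ a : E →L[ℝ] E) = S.φ b := by
    rintro a b rfl
    rfl
  have h2 : S.φInChart p (extChartAt I p p) X = chartDeriv I p (extChartAt I p p)
      ((S.φ ((extChartAt I p).symm (extChartAt I p p)) : E →L[ℝ] E)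
        (chartSymmDeriv I p (extChartAt I p p) X : E) : E) := rfl
  have h3 : ((S.φ ((extChartAt I p).symm (extChartAt I p p)) : E →L[ℝ] E)
        (chartSymmDeriv I p (extChartAt I p p) X : E) : E) = (S.φ p : E →L[ℝ] E) X := by
    rw [chartSymmDeriv_self, h1 h]
    rfl
  exact h2.trans ((chartDeriv_self p _).trans h3)

theorem ξInChart_self : S.ξInChart p (extChartAt I p p) = S.ξ p := by
  have h : (extChartAt I p).symm (extChartAt I p p) = p := extChartAt_to_inv p
  have h1 : ∀ {a b : M}, a = b → (S.ξ a : E) = S.ξ b := by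
    rintro a b rfl
    rfl
  have h2 : S.ξInChart p (extChartAt I p p) = chartDeriv I p (extChartAt I p p)
      (S.ξ ((extChartAt I p).symm (extChartAt I p p)) : E) := rfl
  exact h2.trans ((chartDeriv_self p _).trans (h1 h))

end AlmostContactMetricStructure

section Traces

/-- `B` is a bilinear map. -/
def IsBilin {E W : Type*} [AddCommGroup E] [Module ℝ E] [AddCommGroup W] [Module ℝ W]
    (B : E → E → W) : Prop :=
  ∃ β : E →ₗ[ℝ] E →ₗ[ℝ] W, ∀ u v, B u v = β u v

variable {E : Type*} [NormedAddCommGroup E] [NormedSpace ℝ E] [FiniteDimensional ℝ E]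
  {W : Type*} [AddCommGroup W] [Module ℝ W]

theorem metricTrace_eq_sum {ι : Type*} [Fintype ι] [DecidableEq ι] {b : E →L[ℝ] E →L[ℝ] ℝ}
    (e : Module.Basis ι ℝ E) (he : ∀ i j, b (e i) (e j) = if i = j then 1 else 0)
    {B : E → E → W} (hB : IsBilin B) : metricTrace b B = ∑ i, B (e i) (e i) := by
  obtain ⟨β, hβ⟩ := hB
  let f := Module.finBasis ℝ E
  have hf : ∀ k, f k = ∑ i, e.toMatrix f i k • e i := fun k => (e.sum_toMatrix_smul_self f k).symm
  have he' : ∀ i, e i = ∑ k, f.toMatrix e k i • f k := fun i => (f.sum_toMatrix_smul_self e i).symm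
  have hgram : (Matrix.of fun k l => b (f k) (f l)) = (e.toMatrix f).transpose * e.toMatrix f := by
    ext k l
    rw [Matrix.of_apply, hf k, hf l, Matrix.mul_apply]
    simp only [map_sum, map_smul, sum_apply, smul_apply, smul_eq_mul, he, mul_ite, mul_one,
      mul_zero, Finset.sum_ite_eq', Finset.mem_univ, if_true, Matrix.transpose_apply]
    simp [mul_comm]
  have hinv : (Matrix.of fun k l => b (f k) (f l))⁻¹ = f.toMatrix e * (f.toMatrix e).transpose := by
    rw [hgram]
    apply Matrix.inv_eq_right_inv
    rw [Matrix.mul_assoc, ← Matrix.mul_assoc (e.toMatrix f), e.toMatrix_mul_toMatrix_flip,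
      Matrix.one_mul, ← Matrix.transpose_mul, f.toMatrix_mul_toMatrix_flip, Matrix.transpose_one]
  have h1 : metricTrace b B = ∑ k, ∑ l, (Matrix.of fun k l => b (f k) (f l))⁻¹ k l •
    B (f k) (f l) := rfl
  rw [h1, hinv]
  have h2 : ∀ i, B (e i) (e i) =
      ∑ k, ∑ l, (f.toMatrix e k i * f.toMatrix e l i) • B (f k) (f l) := by
    intro i
    rw [hβ]
    conv_lhs => rw [he' i]
    simp only [map_sum, map_smul, LinearMap.sum_apply, LinearMap.smul_apply, Finset.smul_sum,
      smul_smul, hβ]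
    rw [Finset.sum_comm]
    exact Finset.sum_congr rfl fun k _ => Finset.sum_congr rfl fun l _ => by rw [mul_comm]
  simp_rw [h2, Matrix.mul_apply, Finset.sum_smul, Matrix.transpose_apply]
  rw [Finset.sum_comm (s := (Finset.univ : Finset ι))]
  exact Finset.sum_congr rfl fun k _ => Finset.sum_comm

theorem metricNormSq_eq_sum {ι : Type*} [Fintype ι] [DecidableEq ι] {b : E →L[ℝ] E →L[ℝ] ℝ}
    (e : Module.Basis ι ℝ E) (he : ∀ i j, b (e i) (e j) = if i = j then 1 else 0)
    {B : E → E → ℝ} (hB : IsBilin B) : metricNormSq b B = ∑ i, ∑ j, B (e i) (e j) ^ 2 := by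
  obtain ⟨β, hβ⟩ := hB
  have h1 : ∀ u v, metricTrace b (fun w z => B u w * B v z) = ∑ j, B u (e j) * B v (e j) := by
    intro u v
    exact metricTrace_eq_sum e he ⟨(LinearMap.mul ℝ ℝ).compl₁₂ (β u) (β v), by simp [hβ]⟩
  rw [metricNormSq]
  simp_rw [h1]
  rw [metricTrace_eq_sum e he]
  · simp_rw [pow_two]
  · exact ⟨∑ j, (LinearMap.mul ℝ ℝ).compl₁₂ (β.flip (e j)) (β.flip (e j)), by simp [hβ]⟩

theorem exists_orthonormal_basis {b : E →L[ℝ] E →L[ℝ] ℝ} (hs : ∀ u v, b u v = b v u)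
    (hp : ∀ u, u ≠ 0 → 0 < b u u) :
    ∃ e : Module.Basis (Fin (Module.finrank ℝ E)) ℝ E,
      ∀ i j, b (e i) (e j) = if i = j then 1 else 0 := by
  let β : LinearMap.BilinForm ℝ E := LinearMap.mk₂ ℝ (fun u v => b u v) (by simp) (by simp)
    (by simp) (by simp)
  have hβ : LinearMap.IsSymm β := ⟨fun u v => hs u v⟩
  obtain ⟨v, hv⟩ := LinearMap.BilinForm.exists_orthogonal_basis (K := ℝ) (B := β) hβ
  have hpos : ∀ i, 0 < b (v i) (v i) := fun i => hp _ (v.ne_zero i)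
  have hne : ∀ i, (Real.sqrt (b (v i) (v i)))⁻¹ ≠ 0 := fun i =>
    inv_ne_zero (Real.sqrt_pos.2 (hpos i)).ne'
  refine ⟨v.unitsSMul fun i => Units.mk0 _ (hne i), fun i j => ?_⟩
  simp only [Module.Basis.unitsSMul_apply, Units.smul_mk0, map_smul, smul_apply, smul_eq_mul]
  split_ifs with hij
  · subst hij
    have h1 := Real.mul_self_sqrt (hpos i).le
    have h2 := (Real.sqrt_pos.2 (hpos i)).ne'
    field_simp
    linarith [h1, pow_two (Real.sqrt (b (v i) (v i)))]
  · have : b (v i) (v j) = 0 := hv hij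
    simp [this]

end Traces

section ProductTraces

variable {E₁ : Type*} [NormedAddCommGroup E₁] [NormedSpace ℝ E₁] [FiniteDimensional ℝ E₁]
  {E₂ : Type*} [NormedAddCommGroup E₂] [NormedSpace ℝ E₂] [FiniteDimensional ℝ E₂]
  {W : Type*} [AddCommGroup W] [Module ℝ W]

theorem IsBilin.restrict₁ {B : E₁ × E₂ → E₁ × E₂ → W} (hB : IsBilin B) :
    IsBilin (restrict₁ B) := by
  obtain ⟨β, hβ⟩ := hB
  exact ⟨β.compl₁₂ (LinearMap.inl ℝ E₁ E₂) (LinearMap.inl ℝ E₁ E₂), by simp [_root_.restrict₁, hβ]⟩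

theorem IsBilin.restrict₂ {B : E₁ × E₂ → E₁ × E₂ → W} (hB : IsBilin B) :
    IsBilin (restrict₂ B) := by
  obtain ⟨β, hβ⟩ := hB
  exact ⟨β.compl₁₂ (LinearMap.inr ℝ E₁ E₂) (LinearMap.inr ℝ E₁ E₂), by simp [_root_.restrict₂, hβ]⟩

variable {ι₁ ι₂ : Type*} [Fintype ι₁] [DecidableEq ι₁] [Fintype ι₂] [DecidableEq ι₂]
  {b : E₁ × E₂ →L[ℝ] E₁ × E₂ →L[ℝ] ℝ} {b₁ : E₁ →L[ℝ] E₁ →L[ℝ] ℝ} {b₂ : E₂ →L[ℝ] E₂ →L[ℝ] ℝ}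

theorem prod_orthonormal (hb : ∀ u v, b u v = b₁ u.1 v.1 + b₂ u.2 v.2)
    (e₁ : Module.Basis ι₁ ℝ E₁) (he₁ : ∀ i j, b₁ (e₁ i) (e₁ j) = if i = j then 1 else 0)
    (e₂ : Module.Basis ι₂ ℝ E₂) (he₂ : ∀ i j, b₂ (e₂ i) (e₂ j) = if i = j then 1 else 0)
    (i j : ι₁ ⊕ ι₂) : b (e₁.prod e₂ i) (e₁.prod e₂ j) = if i = j then 1 else 0 := by
  rcases i with i | i <;> rcases j with j | j <;> simp [hb, he₁, he₂]

theorem metricTrace_prod (hb : ∀ u v, b u v = b₁ u.1 v.1 + b₂ u.2 v.2)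
    (e₁ : Module.Basis ι₁ ℝ E₁) (he₁ : ∀ i j, b₁ (e₁ i) (e₁ j) = if i = j then 1 else 0)
    (e₂ : Module.Basis ι₂ ℝ E₂) (he₂ : ∀ i j, b₂ (e₂ i) (e₂ j) = if i = j then 1 else 0)
    {B : E₁ × E₂ → E₁ × E₂ → W} (hB : IsBilin B) :
    metricTrace b B = metricTrace b₁ (restrict₁ B) + metricTrace b₂ (restrict₂ B) := by
  rw [metricTrace_eq_sum _ (prod_orthonormal hb e₁ he₁ e₂ he₂) hB,
    metricTrace_eq_sum e₁ he₁ hB.restrict₁, metricTrace_eq_sum e₂ he₂ hB.restrict₂]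
  simp [restrict₁, restrict₂]

theorem traceNormDefect_eq_sum (hb : ∀ u v, b u v = b₁ u.1 v.1 + b₂ u.2 v.2)
    (e₁ : Module.Basis ι₁ ℝ E₁) (he₁ : ∀ i j, b₁ (e₁ i) (e₁ j) = if i = j then 1 else 0)
    (e₂ : Module.Basis ι₂ ℝ E₂) (he₂ : ∀ i j, b₂ (e₂ i) (e₂ j) = if i = j then 1 else 0)
    {B : E₁ × E₂ → E₁ × E₂ → ℝ} (hB : IsBilin B) (hs : ∀ u v, B u v = B v u) :
    (metricTrace b B) ^ 2 - (metricTrace b₁ (restrict₁ B)) ^ 2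
      - (metricTrace b₂ (restrict₂ B)) ^ 2 - metricNormSq b B + metricNormSq b₁ (restrict₁ B)
      + metricNormSq b₂ (restrict₂ B)
    = 2 * ∑ i, ∑ j, (B (e₁ i, 0) (e₁ i, 0) * B (0, e₂ j) (0, e₂ j)
        - B (e₁ i, 0) (0, e₂ j) ^ 2) := by
  rw [metricTrace_prod hb e₁ he₁ e₂ he₂ hB,
    metricNormSq_eq_sum _ (prod_orthonormal hb e₁ he₁ e₂ he₂) hB,
    metricNormSq_eq_sum e₁ he₁ hB.restrict₁, metricNormSq_eq_sum e₂ he₂ hB.restrict₂,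
    metricTrace_eq_sum e₁ he₁ hB.restrict₁, metricTrace_eq_sum e₂ he₂ hB.restrict₂]
  simp only [Fintype.sum_sum_type, restrict₁, restrict₂,
    Module.Basis.prod_apply, Sum.elim_inl, Sum.elim_inr, Function.comp_apply, LinearMap.inl_apply,
    LinearMap.inr_apply, Finset.sum_add_distrib, Finset.sum_sub_distrib]
  have h1 : ∑ j, ∑ i, B (0, e₂ j) (e₁ i, 0) ^ 2 = ∑ i, ∑ j, B (e₁ i, 0) (0, e₂ j) ^ 2 := by
    rw [Finset.sum_comm]
    simp_rw [hs (0, e₂ _)]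
  rw [h1, ← Finset.sum_mul_sum]
  ring

theorem sum_mixed_identity {V : Type*} [NormedAddCommGroup V] [NormedSpace ℝ V]
    (g : V →L[ℝ] V →L[ℝ] ℝ) (hgp : ∀ u, u ≠ 0 → 0 < g u u)
    (hb : ∀ u v, b u v = b₁ u.1 v.1 + b₂ u.2 v.2)
    (hs₁ : ∀ u v, b₁ u v = b₁ v u) (hp₁ : ∀ u, u ≠ 0 → 0 < b₁ u u)
    (hs₂ : ∀ u v, b₂ u v = b₂ v u) (hp₂ : ∀ u, u ≠ 0 → 0 < b₂ u u)
    {σ : E₁ × E₂ → E₁ × E₂ → V} (hσ : IsBilin σ)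
    {h A : E₁ × E₂ → E₁ × E₂ → ℝ} (hh : IsBilin h) (hhs : ∀ u v, h u v = h v u)
    (hA : IsBilin A) (hAs : ∀ u v, A u v = A v u)
    {Q₁ : E₁ → E₁ → ℝ} (hQ₁ : IsBilin Q₁) {Q₂ : E₂ → E₂ → ℝ} (hQ₂ : IsBilin Q₂)
    {c₁ c₂ f₁ f₄ f₅₁ f₅₂ : ℝ}
    (key : ∀ (X : E₁) (Z : E₂),
      f₁ * (b₁ X X * b₂ Z Z) + f₄ * (h (X, 0) (X, 0) * b₂ Z Z + h (0, Z) (0, Z) * b₁ X X)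
      + f₅₁ * (h (X, 0) (X, 0) * h (0, Z) (0, Z) - h (X, 0) (0, Z) ^ 2)
      + f₅₂ * (A (X, 0) (X, 0) * A (0, Z) (0, Z) - A (X, 0) (0, Z) ^ 2)
      = - (b₂ Z Z * (Q₁ X X / c₁)) - b₁ X X * (Q₂ Z Z / c₂)
        - g (σ (X, 0) (X, 0)) (σ (0, Z) (0, Z)) + g (σ (X, 0) (0, Z)) (σ (X, 0) (0, Z))) :
    ∃ q : ℝ, 0 ≤ q ∧ (q = 0 ↔ ∀ u v, σ (u, 0) (0, v) = 0) ∧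
      metricTrace b σ = metricTrace b₁ (restrict₁ σ) + metricTrace b₂ (restrict₂ σ) ∧
      (Module.finrank ℝ E₂ : ℝ) * (- metricTrace b₁ Q₁ / c₁)
        + Module.finrank ℝ E₁ * (- metricTrace b₂ Q₂ / c₂) =
      g (metricTrace b₁ (restrict₁ σ)) (metricTrace b₂ (restrict₂ σ))
      + Module.finrank ℝ E₁ * Module.finrank ℝ E₂ * f₁
      + f₄ * (Module.finrank ℝ E₂ * metricTrace b₁ (restrict₁ h)
        + Module.finrank ℝ E₁ * metricTrace b₂ (restrict₂ h))
      + 1 / 2 * f₅₁ * ((metricTrace b h) ^ 2 - (metricTrace b₁ (restrict₁ h)) ^ 2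
        - (metricTrace b₂ (restrict₂ h)) ^ 2 - metricNormSq b h + metricNormSq b₁ (restrict₁ h)
        + metricNormSq b₂ (restrict₂ h))
      + 1 / 2 * f₅₂ * ((metricTrace b A) ^ 2 - (metricTrace b₁ (restrict₁ A)) ^ 2
        - (metricTrace b₂ (restrict₂ A)) ^ 2 - metricNormSq b A + metricNormSq b₁ (restrict₁ A)
        + metricNormSq b₂ (restrict₂ A)) - q := by
  obtain ⟨e₁, he₁⟩ := exists_orthonormal_basis hs₁ hp₁
  obtain ⟨e₂, he₂⟩ := exists_orthonormal_basis hs₂ hp₂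
  have hg0 : ∀ u, 0 ≤ g u u := by
    intro u
    rcases eq_or_ne u 0 with rfl | hu
    · simp
    · exact (hgp u hu).le
  refine ⟨∑ i, ∑ j, g (σ (e₁ i, 0) (0, e₂ j)) (σ (e₁ i, 0) (0, e₂ j)),
    Finset.sum_nonneg fun i _ => Finset.sum_nonneg fun j _ => hg0 _, ?_,
    metricTrace_prod hb e₁ he₁ e₂ he₂ hσ, ?_⟩
  · constructor
    · intro h0 u v
      have h1 : ∀ i j, σ (e₁ i, 0) (0, e₂ j) = 0 := by
        intro i j
        by_contra hne
        rw [Finset.sum_eq_zero_iff_of_nonneg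
          fun i _ => Finset.sum_nonneg fun j _ => hg0 _] at h0
        have h2 := h0 i (Finset.mem_univ i)
        rw [Finset.sum_eq_zero_iff_of_nonneg fun j _ => hg0 _] at h2
        have h3 := h2 j (Finset.mem_univ j)
        have h4 := hgp _ hne
        linarith
      obtain ⟨β, hβ⟩ := hσ
      have h2 : (β.compl₁₂ (LinearMap.inl ℝ E₁ E₂) (LinearMap.inr ℝ E₁ E₂)) = 0 := by
        refine e₁.ext fun i => e₂.ext fun j => ?_
        simpa [hβ] using h1 i j
      rw [hβ]
      simpa using LinearMap.congr_fun (LinearMap.congr_fun h2 u) v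
    · intro h0
      simp [h0]
  · rw [traceNormDefect_eq_sum hb e₁ he₁ e₂ he₂ hh hhs,
      traceNormDefect_eq_sum hb e₁ he₁ e₂ he₂ hA hAs,
      metricTrace_eq_sum e₁ he₁ hh.restrict₁, metricTrace_eq_sum e₂ he₂ hh.restrict₂,
      metricTrace_eq_sum e₁ he₁ hσ.restrict₁, metricTrace_eq_sum e₂ he₂ hσ.restrict₂,
      metricTrace_eq_sum e₁ he₁ hQ₁, metricTrace_eq_sum e₂ he₂ hQ₂]
    have hsum := Finset.sum_congr (s₁ := Finset.univ) rfl fun i _ =>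
      Finset.sum_congr (s₁ := Finset.univ) rfl fun j _ => key (e₁ i) (e₂ j)
    simp only [he₁, he₂, if_true, mul_one, one_mul, Finset.sum_add_distrib,
      Finset.sum_sub_distrib, Finset.sum_neg_distrib, ← Finset.mul_sum, ← Finset.sum_div,
      Finset.sum_const, Finset.card_univ, Fintype.card_fin, nsmul_eq_mul, ← Finset.sum_mul] at hsum
    have hT : g (∑ i, restrict₁ σ (e₁ i) (e₁ i)) (∑ j, restrict₂ σ (e₂ j) (e₂ j)) =
        ∑ i, ∑ j, g (σ (e₁ i, 0) (e₁ i, 0)) (σ (0, e₂ j) (0, e₂ j)) := by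
      simp only [restrict₁, restrict₂, map_sum, sum_apply]
      rw [Finset.sum_comm]
    rw [hT]
    simp only [restrict₁, restrict₂, Finset.sum_sub_distrib, ← Finset.sum_mul_sum]
    rw [neg_div, neg_div]
    linear_combination -hsum

end ProductTraces

namespace DoublyWarpedImmersion

variable {n₁ n₂ m : ℕ}
  {M₁ : Type*} [TopologicalSpace M₁] [ChartedSpace (EuclideanSpace ℝ (Fin n₁)) M₁]
  [IsManifold (𝓡 n₁) ∞ M₁]
  {M₂ : Type*} [TopologicalSpace M₂] [ChartedSpace (EuclideanSpace ℝ (Fin n₂)) M₂]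
  [IsManifold (𝓡 n₂) ∞ M₂]
  {N : Type*} [TopologicalSpace N] [ChartedSpace (EuclideanSpace ℝ (Fin (2 * m + 1))) N]
  [IsManifold (𝓡 (2 * m + 1)) ∞ N]
  (D : DoublyWarpedImmersion n₁ n₂ m M₁ M₂ N) (p : M₁ × M₂)

/-- The coordinates of `p`. -/
abbrev coord (p : M₁ × M₂) : EuclideanSpace ℝ (Fin n₁) × EuclideanSpace ℝ (Fin n₂) :=
  (extChartAt (𝓡 n₁) p.1 p.1, extChartAt (𝓡 n₂) p.2 p.2)

/-- The doubly warped metric in coordinates at `p`. -/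
def coordMetric : EuclideanSpace ℝ (Fin n₁) × EuclideanSpace ℝ (Fin n₂) →
    EuclideanSpace ℝ (Fin n₁) × EuclideanSpace ℝ (Fin n₂) →L[ℝ]
    EuclideanSpace ℝ (Fin n₁) × EuclideanSpace ℝ (Fin n₂) →L[ℝ] ℝ :=
  metricInChart ((𝓡 n₁).prod (𝓡 n₂))
    (doublyWarpedMetric (𝓡 n₁) (𝓡 n₂) D.g₁.inner D.g₂.inner D.ρ₁ D.ρ₂) p

/-- The ambient metric in coordinates at `x p`. -/
def ambientMetric : EuclideanSpace ℝ (Fin (2 * m + 1)) →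
    EuclideanSpace ℝ (Fin (2 * m + 1)) →L[ℝ] EuclideanSpace ℝ (Fin (2 * m + 1)) →L[ℝ] ℝ :=
  metricInChart (𝓡 (2 * m + 1)) D.S.g.inner (D.x p)

/-- The immersion in coordinates at `p`. -/
def coordMap : EuclideanSpace ℝ (Fin n₁) × EuclideanSpace ℝ (Fin n₂) →
    EuclideanSpace ℝ (Fin (2 * m + 1)) :=
  mapInCharts ((𝓡 n₁).prod (𝓡 n₂)) (𝓡 (2 * m + 1)) D.x p (D.x p)

theorem extChartAt_self_eq_coord : extChartAt ((𝓡 n₁).prod (𝓡 n₂)) p p = coord p := by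
  rw [extChartAt_prod]
  rfl

theorem coord_mem_target : coord p ∈ (extChartAt ((𝓡 n₁).prod (𝓡 n₂)) p).target := by
  rw [← extChartAt_self_eq_coord]
  exact mem_extChartAt_target p

theorem coordMap_coord : D.coordMap p (coord p) =
    extChartAt (𝓡 (2 * m + 1)) (D.x p) (D.x p) := by
  have h : (extChartAt ((𝓡 n₁).prod (𝓡 n₂)) p).symm (coord p) = p := by
    rw [← extChartAt_self_eq_coord]
    exact extChartAt_to_inv p
  rw [coordMap, mapInCharts, Function.comp_apply, Function.comp_apply, h]

theorem eventually_mem_target : ∀ᶠ y in 𝓝 (coord p),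
    y ∈ (extChartAt ((𝓡 n₁).prod (𝓡 n₂)) p).target ∧
      D.x ((extChartAt ((𝓡 n₁).prod (𝓡 n₂)) p).symm y) ∈
        (extChartAt (𝓡 (2 * m + 1)) (D.x p)).source := by
  refine eventually_mem_target_map D.contMDiff_x (coord_mem_target p) ?_
  rw [← extChartAt_self_eq_coord, extChartAt_to_inv p]
  exact mem_extChartAt_source _

theorem eventually_contDiffAt_coordMap : ∀ᶠ y in 𝓝 (coord p),
    ContDiffAt ℝ ∞ (D.coordMap p) y := by
  filter_upwards [D.eventually_mem_target p] with y hy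
  exact contDiffAt_mapInCharts D.contMDiff_x hy.1 hy.2

theorem isMetricAt_ambientMetric : IsMetricAt (D.ambientMetric p) (D.coordMap p (coord p)) := by
  rw [coordMap_coord]
  exact isMetricAt_metricInChart (mem_extChartAt_target _) D.S.g

theorem eventually_coordMetric_eq : ∀ᶠ y in 𝓝 (coord p), ∀ u v, D.coordMetric p y u v =
    (D.ρ₂ ∘ (extChartAt (𝓡 n₂) p.2).symm) y.2 ^ 2 *
      metricInChart (𝓡 n₁) D.g₁.inner p.1 y.1 u.1 v.1
    + (D.ρ₁ ∘ (extChartAt (𝓡 n₁) p.1).symm) y.1 ^ 2 *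
      metricInChart (𝓡 n₂) D.g₂.inner p.2 y.2 u.2 v.2 := by
  filter_upwards [D.eventually_mem_target p] with y hy u v
  have h := hy.1
  rw [extChartAt_prod] at h
  exact metricInChart_doublyWarpedMetric D.g₁.inner D.g₂.inner D.ρ₁ D.ρ₂ h.1 h.2 u v

theorem contDiffAt_comp_symm {n : ℕ} {M : Type*} [TopologicalSpace M]
    [ChartedSpace (EuclideanSpace ℝ (Fin n)) M] [IsManifold (𝓡 n) ∞ M] {ρ : M → ℝ}
    (hρ : ContMDiff (𝓡 n) 𝓘(ℝ, ℝ) ∞ ρ) {q : M} {y : EuclideanSpace ℝ (Fin n)}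
    (hy : y ∈ (extChartAt (𝓡 n) q).target) :
    ContDiffAt ℝ ∞ (ρ ∘ (extChartAt (𝓡 n) q).symm) y :=
  (hρ.contMDiffAt.comp y (contMDiffAt_extChartAt_symm hy)).contDiffAt

theorem eventually_contDiffAt_comp_symm {n : ℕ} {M : Type*} [TopologicalSpace M]
    [ChartedSpace (EuclideanSpace ℝ (Fin n)) M] [IsManifold (𝓡 n) ∞ M] {ρ : M → ℝ}
    (hρ : ContMDiff (𝓡 n) 𝓘(ℝ, ℝ) ∞ ρ) (q : M) :
    ∀ᶠ y in 𝓝 (extChartAt (𝓡 n) q q), ContDiffAt ℝ ∞ (ρ ∘ (extChartAt (𝓡 n) q).symm) y := by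
  filter_upwards [extChartAt_target_mem_nhds q] with y hy using contDiffAt_comp_symm hρ hy

theorem isMetricAt_coordMetric : IsMetricAt (D.coordMetric p) (coord p) := by
  have ht : ∀ᶠ y in 𝓝 (coord p), y.1 ∈ (extChartAt (𝓡 n₁) p.1).target ∧
      y.2 ∈ (extChartAt (𝓡 n₂) p.2).target := by
    filter_upwards [D.eventually_mem_target p] with y hy
    have h := hy.1
    rw [extChartAt_prod] at h
    exact h
  refine isMetricAt_of_pos ?_ ?_ ?_
  · filter_upwards [ht, (D.eventually_coordMetric_eq p).eventually_nhds] with y hy hG u v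
    have h1 : ContDiffAt ℝ ∞ (fun z : EuclideanSpace ℝ (Fin n₁) × EuclideanSpace ℝ (Fin n₂) =>
        (D.ρ₂ ∘ (extChartAt (𝓡 n₂) p.2).symm) z.2) y :=
      ContDiffAt.comp (g := D.ρ₂ ∘ (extChartAt (𝓡 n₂) p.2).symm) y
        (contDiffAt_comp_symm D.contMDiff_ρ₂ hy.2) contDiffAt_snd
    have h2 : ContDiffAt ℝ ∞ (fun z : EuclideanSpace ℝ (Fin n₁) × EuclideanSpace ℝ (Fin n₂) =>
        (D.ρ₁ ∘ (extChartAt (𝓡 n₁) p.1).symm) z.1) y :=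
      ContDiffAt.comp (g := D.ρ₁ ∘ (extChartAt (𝓡 n₁) p.1).symm) y
        (contDiffAt_comp_symm D.contMDiff_ρ₁ hy.1) contDiffAt_fst
    have h3 : ContDiffAt ℝ ∞ (fun z : EuclideanSpace ℝ (Fin n₁) × EuclideanSpace ℝ (Fin n₂) =>
        metricInChart (𝓡 n₁) D.g₁.inner p.1 z.1 u.1 v.1) y :=
      ContDiffAt.comp y (contDiffAt_metricInChart_apply hy.1 D.g₁ u.1 v.1) contDiffAt_fst
    have h4 : ContDiffAt ℝ ∞ (fun z : EuclideanSpace ℝ (Fin n₁) × EuclideanSpace ℝ (Fin n₂) =>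
        metricInChart (𝓡 n₂) D.g₂.inner p.2 z.2 u.2 v.2) y :=
      ContDiffAt.comp y (contDiffAt_metricInChart_apply hy.2 D.g₂ u.2 v.2) contDiffAt_snd
    refine (((h1.pow 2).mul h3).add ((h2.pow 2).mul h4)).congr_of_eventuallyEq ?_
    filter_upwards [hG] with z hz using hz u v
  · filter_upwards [D.eventually_coordMetric_eq p] with y hy u v
    rw [hy, hy, metricInChart_apply, metricInChart_apply, metricInChart_apply,
      metricInChart_apply, D.g₁.symm, D.g₂.symm]
  · filter_upwards [ht, D.eventually_coordMetric_eq p] with y hy hG u hu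
    have h1 : 0 < (D.ρ₂ ∘ (extChartAt (𝓡 n₂) p.2).symm) y.2 ^ 2 := pow_pos (D.ρ₂_pos _) 2
    have h2 : 0 < (D.ρ₁ ∘ (extChartAt (𝓡 n₁) p.1).symm) y.1 ^ 2 := pow_pos (D.ρ₁_pos _) 2
    have h3 : ∀ w, w ≠ 0 → 0 < metricInChart (𝓡 n₁) D.g₁.inner p.1 y.1 w w :=
      fun w hw => D.g₁.pos _ _ (chartSymmDeriv_ne_zero hy.1 hw)
    have h4 : ∀ w, w ≠ 0 → 0 < metricInChart (𝓡 n₂) D.g₂.inner p.2 y.2 w w :=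
      fun w hw => D.g₂.pos _ _ (chartSymmDeriv_ne_zero hy.2 hw)
    rw [hG]
    rcases eq_or_ne u.1 0 with hu1 | hu1
    · have hu2 : u.2 ≠ 0 := fun h => hu (Prod.ext hu1 h)
      rw [hu1, map_zero, mul_zero, zero_add]
      exact mul_pos h2 (h4 _ hu2)
    · rcases eq_or_ne u.2 0 with hu2 | hu2
      · rw [hu2, map_zero, mul_zero, add_zero]
        exact mul_pos h1 (h3 _ hu1)
      · exact add_pos (mul_pos h1 (h3 _ hu1)) (mul_pos h2 (h4 _ hu2))

theorem symm_coordMap {y : EuclideanSpace ℝ (Fin n₁) × EuclideanSpace ℝ (Fin n₂)}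
    (hy : D.x ((extChartAt ((𝓡 n₁).prod (𝓡 n₂)) p).symm y) ∈
        (extChartAt (𝓡 (2 * m + 1)) (D.x p)).source) :
    (extChartAt (𝓡 (2 * m + 1)) (D.x p)).symm (D.coordMap p y) =
      D.x ((extChartAt ((𝓡 n₁).prod (𝓡 n₂)) p).symm y) :=
  (extChartAt (𝓡 (2 * m + 1)) (D.x p)).left_inv hy

theorem eventually_coordMetric_pull : ∀ᶠ y in 𝓝 (coord p), ∀ u v, D.coordMetric p y u v =
    D.ambientMetric p (D.coordMap p y) (fderiv ℝ (D.coordMap p) y u)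
      (fderiv ℝ (D.coordMap p) y v) := by
  filter_upwards [D.eventually_mem_target p] with y hy u v
  have h1 : D.ambientMetric p (D.coordMap p y) (fderiv ℝ (D.coordMap p) y u)
      (fderiv ℝ (D.coordMap p) y v) =
      (D.S.g.inner ((extChartAt (𝓡 (2 * m + 1)) (D.x p)).symm (D.coordMap p y)) :
        EuclideanSpace ℝ (Fin (2 * m + 1)) →L[ℝ] EuclideanSpace ℝ (Fin (2 * m + 1)) →L[ℝ] ℝ)
      (chartSymmDeriv (𝓡 (2 * m + 1)) (D.x p) (D.coordMap p y) (fderiv ℝ (D.coordMap p) y u) :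
        EuclideanSpace ℝ (Fin (2 * m + 1)))
      (chartSymmDeriv (𝓡 (2 * m + 1)) (D.x p) (D.coordMap p y) (fderiv ℝ (D.coordMap p) y v) :
        EuclideanSpace ℝ (Fin (2 * m + 1))) := rfl
  have h2 : ∀ u, (chartSymmDeriv (𝓡 (2 * m + 1)) (D.x p) (D.coordMap p y)
      (fderiv ℝ (D.coordMap p) y u) : EuclideanSpace ℝ (Fin (2 * m + 1))) = _ :=
    fderiv_mapInCharts D.contMDiff_x hy.1 hy.2
  rw [h1, h2, h2, metric_congr D.S.g.inner (D.symm_coordMap p hy.2)]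
  exact (D.isometric _ _ _).symm

theorem eventually_η_eq_zero (hreal : D.IsCTotallyReal) : ∀ᶠ y in 𝓝 (coord p), ∀ u,
    D.S.ηInChart (D.x p) (D.coordMap p y) (fderiv ℝ (D.coordMap p) y u) = 0 := by
  filter_upwards [D.eventually_mem_target p] with y hy u
  have h1 : D.S.ηInChart (D.x p) (D.coordMap p y) (fderiv ℝ (D.coordMap p) y u) =
      (D.S.η ((extChartAt (𝓡 (2 * m + 1)) (D.x p)).symm (D.coordMap p y)) :
        EuclideanSpace ℝ (Fin (2 * m + 1)) →L[ℝ] ℝ)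
      (chartSymmDeriv (𝓡 (2 * m + 1)) (D.x p) (D.coordMap p y) (fderiv ℝ (D.coordMap p) y u) :
        EuclideanSpace ℝ (Fin (2 * m + 1))) := rfl
  have h2 : ∀ u, (chartSymmDeriv (𝓡 (2 * m + 1)) (D.x p) (D.coordMap p y)
      (fderiv ℝ (D.coordMap p) y u) : EuclideanSpace ℝ (Fin (2 * m + 1))) = _ :=
    fderiv_mapInCharts D.contMDiff_x hy.1 hy.2
  rw [h1, h2, covector_congr D.S.η (D.symm_coordMap p hy.2)]
  exact hreal _ _

theorem isContactMetricAt_ambientMetric (hcontact : D.S.IsContactMetric) :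
    IsContactMetricAt (D.ambientMetric p) (D.S.φInChart (D.x p)) (D.S.ξInChart (D.x p))
      (D.S.ηInChart (D.x p)) (D.coordMap p (coord p)) := by
  rw [coordMap_coord]
  exact D.S.isContactMetricAt_inChart hcontact (mem_extChartAt_target _)

theorem dx_eq (u : EuclideanSpace ℝ (Fin n₁) × EuclideanSpace ℝ (Fin n₂)) :
    (D.dx p u : EuclideanSpace ℝ (Fin (2 * m + 1))) = fderiv ℝ (D.coordMap p) (coord p) u := by
  rw [← extChartAt_self_eq_coord]
  exact mfderiv_eq_fderiv_mapInCharts D.contMDiff_x p u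

theorem ambientMetric_coord (u v : EuclideanSpace ℝ (Fin (2 * m + 1))) :
    D.ambientMetric p (D.coordMap p (coord p)) u v = D.S.g.inner (D.x p) u v := by
  rw [coordMap_coord]
  exact metricInChart_self D.S.g.inner (D.x p) u v

theorem σ_eq (u v : EuclideanSpace ℝ (Fin n₁) × EuclideanSpace ℝ (Fin n₂)) :
    (D.σ p u v : EuclideanSpace ℝ (Fin (2 * m + 1))) =
      coordSecondFundamentalForm (D.coordMetric p) (D.ambientMetric p) (D.coordMap p) (coord p)
        u v := by
  have h : ∀ w₁ w₂ w₃ : EuclideanSpace ℝ (Fin (2 * m + 1)), D.dx p u = w₁ → D.dx p v = w₂ →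
      D.dx p (christoffel (D.coordMetric p) (extChartAt ((𝓡 n₁).prod (𝓡 n₂)) p p) u v) = w₃ →
      D.σ p u v = fderiv ℝ (fderiv ℝ (D.coordMap p)) (extChartAt ((𝓡 n₁).prod (𝓡 n₂)) p p) u v
        + christoffel (D.ambientMetric p) (extChartAt (𝓡 (2 * m + 1)) (D.x p) (D.x p)) w₁ w₂
        - w₃ := by
    rintro _ _ _ rfl rfl rfl
    rfl
  refine (h _ _ _ (D.dx_eq p _) (D.dx_eq p _) (D.dx_eq p _)).trans ?_
  rw [← coordMap_coord, extChartAt_self_eq_coord]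
  rfl

theorem metric_apply (u v : EuclideanSpace ℝ (Fin n₁) × EuclideanSpace ℝ (Fin n₂)) :
    D.metric p u v = D.metric₁ p u.1 v.1 + D.metric₂ p u.2 v.2 := by
  have h1 : D.metric p u v = D.coordMetric p (coord p) u v := by
    rw [← extChartAt_self_eq_coord]
    exact (metricInChart_self _ p u v).symm
  have h2 : (extChartAt (𝓡 n₁) p.1).symm (extChartAt (𝓡 n₁) p.1 p.1) = p.1 :=
    extChartAt_to_inv p.1
  have h3 : (extChartAt (𝓡 n₂) p.2).symm (extChartAt (𝓡 n₂) p.2 p.2) = p.2 :=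
    extChartAt_to_inv p.2
  rw [h1, (D.eventually_coordMetric_eq p).self_of_nhds, metricInChart_self, metricInChart_self,
    Function.comp_apply, Function.comp_apply, h2, h3]
  rfl

end DoublyWarpedImmersion

theorem AlmostContactMetricStructure.inner_curvatureTensor
    {E : Type*} [NormedAddCommGroup E] [NormedSpace ℝ E]
    {H : Type*} [TopologicalSpace H] {I : ModelWithCorners ℝ E H}
    {M : Type*} [TopologicalSpace M] [ChartedSpace H M] [IsManifold I ∞ M]
    (S : AlmostContactMetricStructure I M) {f₁ f₂ f₃ f₄ f₅₁ f₅₂ f₆ : M → ℝ}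
    (hS : S.IsGeneralizedKappaMuSpaceForm f₁ f₂ f₃ f₄ f₅₁ f₅₂ f₆) {p : M} {U V : TangentSpace I p}
    (hU : S.η p U = 0) (hV : S.η p V = 0) (hUφV : S.g.inner p U (S.φ p V) = 0)
    (hVφV : S.g.inner p V (S.φ p V) = 0) (hUV : S.g.inner p U V = 0) :
    S.g.inner p (curvatureTensor I S.g.inner p U V V) U =
      f₁ p * (S.g.inner p U U * S.g.inner p V V)
      + f₄ p * (S.g.inner p (S.h p U) U * S.g.inner p V V
        + S.g.inner p (S.h p V) V * S.g.inner p U U)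
      + f₅₁ p * (S.g.inner p (S.h p U) U * S.g.inner p (S.h p V) V
        - S.g.inner p (S.h p U) V * S.g.inner p (S.h p V) U)
      + f₅₂ p * (S.g.inner p (S.φ p (S.h p U)) U * S.g.inner p (S.φ p (S.h p V)) V
        - S.g.inner p (S.φ p (S.h p U)) V * S.g.inner p (S.φ p (S.h p V)) U) := by
  rw [hS, R₁, R₂, R₃, R₄, R₅₁, R₅₂, R₆, hU, hV, hUφV, hVφV, hUV]
  simp only [mul_zero, zero_smul, sub_zero, add_zero, smul_zero, map_add, map_sub,
    map_smul, add_apply, sub_apply, smul_apply, smul_eq_mul, S.g.symm p V U, hUV]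
  ring

namespace DoublyWarpedImmersion

variable {n₁ n₂ m : ℕ}
  {M₁ : Type*} [TopologicalSpace M₁] [ChartedSpace (EuclideanSpace ℝ (Fin n₁)) M₁]
  [IsManifold (𝓡 n₁) ∞ M₁]
  {M₂ : Type*} [TopologicalSpace M₂] [ChartedSpace (EuclideanSpace ℝ (Fin n₂)) M₂]
  [IsManifold (𝓡 n₂) ∞ M₂]
  {N : Type*} [TopologicalSpace N] [ChartedSpace (EuclideanSpace ℝ (Fin (2 * m + 1))) N]
  [IsManifold (𝓡 (2 * m + 1)) ∞ N]
  (D : DoublyWarpedImmersion n₁ n₂ m M₁ M₂ N) (p : M₁ × M₂)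

theorem hessian_const_smul {n : ℕ} {M : Type*} [TopologicalSpace M]
    [ChartedSpace (EuclideanSpace ℝ (Fin n)) M] [IsManifold (𝓡 n) ∞ M]
    (g : ContMDiffRiemannianMetric (𝓡 n) ∞ (EuclideanSpace ℝ (Fin n))
      (fun x : M => TangentSpace (𝓡 n) x)) {c : ℝ} (hc : c ≠ 0) (ψ : M → ℝ) (q : M)
    (u v : EuclideanSpace ℝ (Fin n)) :
    hessian (𝓡 n) (fun x => c • g.inner x) ψ q u v =
      fderiv ℝ (fderiv ℝ (ψ ∘ (extChartAt (𝓡 n) q).symm)) (extChartAt (𝓡 n) q q) u v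
      - fderiv ℝ (ψ ∘ (extChartAt (𝓡 n) q).symm) (extChartAt (𝓡 n) q q)
          (christoffel (metricInChart (𝓡 n) g.inner q) (extChartAt (𝓡 n) q q) u v) := by
  have h : metricInChart (𝓡 n) (fun x => c • g.inner x) q =
      fun z => c • metricInChart (𝓡 n) g.inner q z := rfl
  rw [hessian, h, christoffel_const_smul
    (isMetricAt_metricInChart (mem_extChartAt_target q) g).isInvertible.self_of_nhds c hc]

theorem isBilin_hessian {E : Type*} [NormedAddCommGroup E] [NormedSpace ℝ E]
    [FiniteDimensional ℝ E] {H : Type*} [TopologicalSpace H] (I : ModelWithCorners ℝ E H)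
    {M : Type*} [TopologicalSpace M] [ChartedSpace H M]
    (g : ∀ x : M, TangentSpace I x →L[ℝ] TangentSpace I x →L[ℝ] ℝ) (ψ : M → ℝ) (q : M) :
    IsBilin (hessian I g ψ q) := by
  refine ⟨LinearMap.mk₂ ℝ (hessian I g ψ q) ?_ ?_ ?_ ?_, fun u v => rfl⟩ <;> intros <;>
    simp only [hessian, ← christoffelCLM_apply, map_add, map_smul, add_apply, smul_apply,
      smul_eq_mul] <;> ring

theorem isBilin_σ : IsBilin (W := EuclideanSpace ℝ (Fin (2 * m + 1))) (D.σ p) := by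
  refine ⟨LinearMap.mk₂ ℝ (coordSecondFundamentalForm (D.coordMetric p) (D.ambientMetric p)
    (D.coordMap p) (coord p)) ?_ ?_ ?_ ?_, fun u v => D.σ_eq p u v⟩ <;> intros <;>
    simp only [coordSecondFundamentalForm, pushCovDeriv, ← christoffelCLM_apply, map_add, map_smul,
      add_apply, smul_apply] <;> module

theorem isBilin_Aξ : IsBilin (D.Aξ p) := by
  obtain ⟨β, hβ⟩ := D.isBilin_σ p
  let g : EuclideanSpace ℝ (Fin (2 * m + 1)) →L[ℝ] EuclideanSpace ℝ (Fin (2 * m + 1)) →L[ℝ] ℝ :=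
    D.S.g.inner (D.x p)
  let w : EuclideanSpace ℝ (Fin (2 * m + 1)) := D.S.ξ (D.x p)
  have h : ∀ u v, D.Aξ p u v = g (β u v) w := fun u v => congrArg (fun z => g z w) (hβ u v)
  refine ⟨LinearMap.mk₂ ℝ (fun u v => g (β u v) w) ?_ ?_ ?_ ?_, h⟩ <;> intros <;>
    simp

theorem hT_eq (u v : EuclideanSpace ℝ (Fin n₁) × EuclideanSpace ℝ (Fin n₂)) :
    D.hT p u v = D.ambientMetric p (D.coordMap p (coord p))
      ((1 / 2 : ℝ) • lieEnd (D.S.φInChart (D.x p)) (D.S.ξInChart (D.x p)) (D.coordMap p (coord p))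
        (fderiv ℝ (D.coordMap p) (coord p) u)) (fderiv ℝ (D.coordMap p) (coord p) v) := by
  rw [ambientMetric_coord, ← dx_eq, ← dx_eq, coordMap_coord]
  rfl

theorem isBilin_hT : IsBilin (D.hT p) := by
  refine ⟨LinearMap.mk₂ ℝ (D.hT p) ?_ ?_ ?_ ?_, fun u v => rfl⟩ <;> intros <;>
    simp only [hT_eq, lieEnd, map_add, map_sub, map_smul, add_apply, sub_apply, smul_apply,
      smul_eq_mul] <;> ring

theorem hT_symm (hcontact : D.S.IsContactMetric)
    (u v : EuclideanSpace ℝ (Fin n₁) × EuclideanSpace ℝ (Fin n₂)) : D.hT p u v = D.hT p v u := by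
  rw [hT_eq, hT_eq, map_smul, map_smul, smul_apply, smul_apply,
    (D.isContactMetricAt_ambientMetric p hcontact).lieEnd_symm]

theorem σ_symm (u v : EuclideanSpace ℝ (Fin n₁) × EuclideanSpace ℝ (Fin n₂)) :
    D.σ p u v = D.σ p v u :=
  (D.σ_eq p u v).trans ((coordSecondFundamentalForm_symm (D.isMetricAt_coordMetric p)
    (D.isMetricAt_ambientMetric p) (D.eventually_contDiffAt_coordMap p).self_of_nhds u v).trans
    (D.σ_eq p v u).symm)

theorem Aξ_symm (u v : EuclideanSpace ℝ (Fin n₁) × EuclideanSpace ℝ (Fin n₂)) :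
    D.Aξ p u v = D.Aξ p v u := by
  rw [Aξ, σ_symm, Aξ]

theorem inner_φ_h (hcontact : D.S.IsContactMetric) (hreal : D.IsCTotallyReal)
    (u v : EuclideanSpace ℝ (Fin n₁) × EuclideanSpace ℝ (Fin n₂)) :
    D.S.g.inner (D.x p) (D.S.φ (D.x p) (D.S.h (D.x p) (D.dx p u))) (D.dx p v) = D.Aξ p u v := by
  have h := (D.isContactMetricAt_ambientMetric p hcontact).apply_coordSecondFundamentalForm_ξ
    (D.eventually_contDiffAt_coordMap p).self_of_nhds (D.eventually_η_eq_zero p hreal)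
    (D.coordMetric p) u v
  rw [ambientMetric_coord, ambientMetric_coord, coordMap_coord, D.S.φInChart_self,
    D.S.ξInChart_self, ← σ_eq, ← dx_eq, ← dx_eq] at h
  exact h.symm

theorem inner_dx_φ_dx (hcontact : D.S.IsContactMetric) (hreal : D.IsCTotallyReal)
    (u v : EuclideanSpace ℝ (Fin n₁) × EuclideanSpace ℝ (Fin n₂)) :
    D.S.g.inner (D.x p) (D.dx p u) (D.S.φ (D.x p) (D.dx p v)) = 0 := by
  have h := (D.isContactMetricAt_ambientMetric p hcontact).apply_φ_eq_zero
    (D.eventually_contDiffAt_coordMap p).self_of_nhds (D.eventually_η_eq_zero p hreal) u v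
  rw [ambientMetric_coord, coordMap_coord, D.S.φInChart_self, ← dx_eq, ← dx_eq] at h
  exact h

theorem inner_dx (u v : EuclideanSpace ℝ (Fin n₁) × EuclideanSpace ℝ (Fin n₂)) :
    D.S.g.inner (D.x p) (D.dx p u) (D.dx p v) = D.metric₁ p u.1 v.1 + D.metric₂ p u.2 v.2 :=
  (D.isometric p u v).trans (D.metric_apply p u v)

/-- The Gauss equation for mixed planes. -/
theorem inner_curvatureTensor (X : EuclideanSpace ℝ (Fin n₁)) (Z : EuclideanSpace ℝ (Fin n₂)) :
    D.S.g.inner (D.x p) (curvatureTensor (𝓡 (2 * m + 1)) D.S.g.inner (D.x p) (D.dx p (X, 0))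
      (D.dx p (0, Z)) (D.dx p (0, Z))) (D.dx p (X, 0)) =
    - (D.metric₂ p Z Z * (hessian (𝓡 n₁) (leafMetric₁ (𝓡 n₁) D.g₁.inner D.ρ₂ p.2) D.ρ₁ p.1 X X
        / D.ρ₁ p.1))
      - D.metric₁ p X X * (hessian (𝓡 n₂) (leafMetric₂ (𝓡 n₂) D.g₂.inner D.ρ₁ p.1) D.ρ₂ p.2 Z Z
        / D.ρ₂ p.2)
      - D.S.g.inner (D.x p) (D.σ p (X, 0) (X, 0)) (D.σ p (0, Z) (0, Z))
      + D.S.g.inner (D.x p) (D.σ p (X, 0) (0, Z)) (D.σ p (X, 0) (0, Z)) := by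
  have e₁ : (extChartAt (𝓡 n₁) p.1).symm (extChartAt (𝓡 n₁) p.1 p.1) = p.1 :=
    extChartAt_to_inv p.1
  have e₂ : (extChartAt (𝓡 n₂) p.2).symm (extChartAt (𝓡 n₂) p.2 p.2) = p.2 :=
    extChartAt_to_inv p.2
  have hρ₁ := (D.ρ₁_pos p.1).ne'
  have hρ₂ := (D.ρ₂_pos p.2).ne'
  have h := gauss_warped (D.isMetricAt_coordMetric p)
    (isMetricAt_metricInChart (mem_extChartAt_target p.1) D.g₁)
    (isMetricAt_metricInChart (mem_extChartAt_target p.2) D.g₂)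
    (eventually_contDiffAt_comp_symm D.contMDiff_ρ₁ p.1)
    (eventually_contDiffAt_comp_symm D.contMDiff_ρ₂ p.2)
    (D.ρ₁_pos _).ne' (D.ρ₂_pos _).ne' (D.eventually_coordMetric_eq p)
    (D.isMetricAt_ambientMetric p) (D.eventually_contDiffAt_coordMap p)
    (D.eventually_coordMetric_pull p) X Z
  rw [← hessian_const_smul D.g₁ (pow_ne_zero 2 hρ₂), ← hessian_const_smul D.g₂ (pow_ne_zero 2 hρ₁),
    ambientMetric_coord, ambientMetric_coord, ambientMetric_coord, coordMap_coord, ← σ_eq, ← σ_eq,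
    ← σ_eq, ← dx_eq, ← dx_eq, metricInChart_self, metricInChart_self, Function.comp_apply,
    Function.comp_apply, e₁, e₂] at h
  refine h.trans ?_
  have k₁ : D.metric₁ p X X = D.ρ₂ p.2 ^ 2 * D.g₁.inner p.1 X X := rfl
  have k₂ : D.metric₂ p Z Z = D.ρ₁ p.1 ^ 2 * D.g₂.inner p.2 Z Z := rfl
  have l₁ : leafMetric₁ (𝓡 n₁) D.g₁.inner D.ρ₂ p.2 = fun x => D.ρ₂ p.2 ^ 2 • D.g₁.inner x := rfl
  have l₂ : leafMetric₂ (𝓡 n₂) D.g₂.inner D.ρ₁ p.1 = fun x => D.ρ₁ p.1 ^ 2 • D.g₂.inner x := rfl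
  rw [k₁, k₂, l₁, l₂]
  field_simp

theorem mixed_curvature_identity (hcontact : D.S.IsContactMetric) {f₁ f₂ f₃ f₄ f₅₁ f₅₂ f₆ : N → ℝ}
    (hform : D.S.IsGeneralizedKappaMuSpaceForm f₁ f₂ f₃ f₄ f₅₁ f₅₂ f₆) (hreal : D.IsCTotallyReal)
    (X : EuclideanSpace ℝ (Fin n₁)) (Z : EuclideanSpace ℝ (Fin n₂)) :
    f₁ (D.x p) * (D.metric₁ p X X * D.metric₂ p Z Z)
      + f₄ (D.x p) * (D.hT p (X, 0) (X, 0) * D.metric₂ p Z Z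
        + D.hT p (0, Z) (0, Z) * D.metric₁ p X X)
      + f₅₁ (D.x p) * (D.hT p (X, 0) (X, 0) * D.hT p (0, Z) (0, Z) - D.hT p (X, 0) (0, Z) ^ 2)
      + f₅₂ (D.x p) * (D.Aξ p (X, 0) (X, 0) * D.Aξ p (0, Z) (0, Z) - D.Aξ p (X, 0) (0, Z) ^ 2) =
    - (D.metric₂ p Z Z * (hessian (𝓡 n₁) (leafMetric₁ (𝓡 n₁) D.g₁.inner D.ρ₂ p.2) D.ρ₁ p.1 X X
        / D.ρ₁ p.1))
      - D.metric₁ p X X * (hessian (𝓡 n₂) (leafMetric₂ (𝓡 n₂) D.g₂.inner D.ρ₁ p.1) D.ρ₂ p.2 Z Z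
        / D.ρ₂ p.2)
      - D.S.g.inner (D.x p) (D.σ p (X, 0) (X, 0)) (D.σ p (0, Z) (0, Z))
      + D.S.g.inner (D.x p) (D.σ p (X, 0) (0, Z)) (D.σ p (X, 0) (0, Z)) := by
  rw [← inner_curvatureTensor, D.S.inner_curvatureTensor hform (hreal p _) (hreal p _)
    (D.inner_dx_φ_dx p hcontact hreal _ _) (D.inner_dx_φ_dx p hcontact hreal _ _)
    (by simp [inner_dx])]
  have hh : ∀ u v, D.S.g.inner (D.x p) (D.S.h (D.x p) (D.dx p u)) (D.dx p v) = D.hT p u v :=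
    fun _ _ => rfl
  simp only [D.inner_φ_h p hcontact hreal, hh, inner_dx, map_zero, add_zero, zero_add]
  rw [D.Aξ_symm p (0, Z) (X, 0), D.hT_symm p hcontact (0, Z) (X, 0), pow_two, pow_two]

end DoublyWarpedImmersion

theorem finrank_smul_inv_smul_metricTrace {E : Type*} [NormedAddCommGroup E] [NormedSpace ℝ E]
    [FiniteDimensional ℝ E] {W : Type*} [AddCommGroup W] [Module ℝ W] {n : ℕ}
    (hn : Module.finrank ℝ E = n) (b : E →L[ℝ] E →L[ℝ] ℝ) (B : E → E → W) :
    (n : ℝ) • (n : ℝ)⁻¹ • metricTrace b B = metricTrace b B := by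
  rcases eq_or_ne n 0 with h | h
  · have : IsEmpty (Fin (Module.finrank ℝ E)) := by
      rw [hn, h]
      infer_instance
    simp [metricTrace]
  · rw [smul_inv_smul₀ (Nat.cast_ne_zero.2 h)]

namespace DoublyWarpedImmersion

variable {n₁ n₂ m : ℕ}
  {M₁ : Type*} [TopologicalSpace M₁] [ChartedSpace (EuclideanSpace ℝ (Fin n₁)) M₁]
  [IsManifold (𝓡 n₁) ∞ M₁]
  {M₂ : Type*} [TopologicalSpace M₂] [ChartedSpace (EuclideanSpace ℝ (Fin n₂)) M₂]
  [IsManifold (𝓡 n₂) ∞ M₂]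
  {N : Type*} [TopologicalSpace N] [ChartedSpace (EuclideanSpace ℝ (Fin (2 * m + 1))) N]
  [IsManifold (𝓡 (2 * m + 1)) ∞ N]
  (D : DoublyWarpedImmersion n₁ n₂ m M₁ M₂ N) (p : M₁ × M₂)

theorem smul_meanCurvature : ((n₁ + n₂ : ℕ) : ℝ) • D.meanCurvature p =
    metricTrace (D.metric p) (D.σ p) :=
  finrank_smul_inv_smul_metricTrace (by simp) _ _

theorem smul_meanCurvature₁ : (n₁ : ℝ) • D.meanCurvature₁ p =
    metricTrace (D.metric₁ p) (restrict₁ (D.σ p)) :=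
  finrank_smul_inv_smul_metricTrace (by simp) _ _

theorem smul_meanCurvature₂ : (n₂ : ℝ) • D.meanCurvature₂ p =
    metricTrace (D.metric₂ p) (restrict₂ (D.σ p)) :=
  finrank_smul_inv_smul_metricTrace (by simp) _ _

theorem metric₁_symm (u v : EuclideanSpace ℝ (Fin n₁)) :
    D.metric₁ p u v = D.metric₁ p v u :=
  congrArg (fun t => D.ρ₂ p.2 ^ 2 * t) (D.g₁.symm p.1 u v)

theorem metric₂_symm (u v : EuclideanSpace ℝ (Fin n₂)) :
    D.metric₂ p u v = D.metric₂ p v u :=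
  congrArg (fun t => D.ρ₁ p.1 ^ 2 * t) (D.g₂.symm p.2 u v)

theorem metric₁_pos (u : EuclideanSpace ℝ (Fin n₁)) (hu : u ≠ 0) : 0 < D.metric₁ p u u :=
  mul_pos (pow_pos (D.ρ₂_pos p.2) 2) (D.g₁.pos p.1 u hu)

theorem metric₂_pos (u : EuclideanSpace ℝ (Fin n₂)) (hu : u ≠ 0) : 0 < D.metric₂ p u u :=
  mul_pos (pow_pos (D.ρ₁_pos p.1) 2) (D.g₂.pos p.2 u hu)

theorem exists_upperBound_eq (hcontact : D.S.IsContactMetric) {f₁ f₂ f₃ f₄ f₅₁ f₅₂ f₆ : N → ℝ}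
    (hform : D.S.IsGeneralizedKappaMuSpaceForm f₁ f₂ f₃ f₄ f₅₁ f₅₂ f₆)
    (hreal : D.IsCTotallyReal) :
    ∃ q : ℝ, 0 ≤ q ∧ (q = 0 ↔ ∀ u v, D.σ p (u, 0) (0, v) = 0) ∧
      D.upperBound f₁ f₄ f₅₁ f₅₂ p = D.warpingTerm p
        + 1 / 4 * D.S.g.inner (D.x p)
          ((n₁ : ℝ) • D.meanCurvature₁ p - (n₂ : ℝ) • D.meanCurvature₂ p)
          ((n₁ : ℝ) • D.meanCurvature₁ p - (n₂ : ℝ) • D.meanCurvature₂ p) + q := by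
  obtain ⟨q, hq, hq0, hT, h⟩ := sum_mixed_identity (V := EuclideanSpace ℝ (Fin (2 * m + 1)))
    (D.S.g.inner (D.x p)) (fun u hu => D.S.g.pos (D.x p) u hu) (D.metric_apply p)
    (D.metric₁_symm p) (D.metric₁_pos p) (D.metric₂_symm p) (D.metric₂_pos p) (D.isBilin_σ p)
    (D.isBilin_hT p) (D.hT_symm p hcontact) (D.isBilin_Aξ p) (D.Aξ_symm p)
    (isBilin_hessian (𝓡 n₁) (leafMetric₁ (𝓡 n₁) D.g₁.inner D.ρ₂ p.2) D.ρ₁ p.1)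
    (isBilin_hessian (𝓡 n₂) (leafMetric₂ (𝓡 n₂) D.g₂.inner D.ρ₁ p.1) D.ρ₂ p.2)
    (D.mixed_curvature_identity p hcontact hform hreal)
  refine ⟨q, hq, hq0, ?_⟩
  rw [finrank_euclideanSpace_fin, finrank_euclideanSpace_fin] at h
  have hH : ((n₁ + n₂ : ℕ) : ℝ) ^ 2 / 4 *
      D.S.g.inner (D.x p) (D.meanCurvature p) (D.meanCurvature p) = 1 / 4 *
      D.S.g.inner (D.x p) (((n₁ + n₂ : ℕ) : ℝ) • D.meanCurvature p)
        (((n₁ + n₂ : ℕ) : ℝ) • D.meanCurvature p) := by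
    rw [map_smul, map_smul, smul_apply, smul_eq_mul, smul_eq_mul]
    ring
  have hw : D.warpingTerm p = D.S.g.inner (D.x p) (metricTrace (D.metric₁ p) (restrict₁ (D.σ p)))
    (metricTrace (D.metric₂ p) (restrict₂ (D.σ p))) + _ + _ + _ + _ - q := h
  have hs := D.S.g.symm (D.x p) (metricTrace (D.metric₂ p) (restrict₂ (D.σ p)))
    (metricTrace (D.metric₁ p) (restrict₁ (D.σ p)))
  have hT' : metricTrace (D.metric p) (D.σ p) =
    metricTrace (D.metric₁ p) (restrict₁ (D.σ p)) +
      metricTrace (D.metric₂ p) (restrict₂ (D.σ p)) := hT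
  rw [upperBound, hH, smul_meanCurvature, smul_meanCurvature₁, smul_meanCurvature₂, hw, hT',
    traceNormDefect, traceNormDefect]
  generalize metricTrace (D.metric₁ p) (restrict₁ (D.σ p)) = T₁ at hs ⊢
  generalize metricTrace (D.metric₂ p) (restrict₂ (D.σ p)) = T₂ at hs ⊢
  simp only [map_add, map_sub, add_apply, sub_apply, hs]
  ring

end DoublyWarpedImmersion

theorem mainTheorem2 {n₁ n₂ m : ℕ}
    {M₁ : Type*} [TopologicalSpace M₁] [ChartedSpace (EuclideanSpace ℝ (Fin n₁)) M₁]
    [IsManifold (𝓡 n₁) ∞ M₁]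
    {M₂ : Type*} [TopologicalSpace M₂] [ChartedSpace (EuclideanSpace ℝ (Fin n₂)) M₂]
    [IsManifold (𝓡 n₂) ∞ M₂]
    {N : Type*} [TopologicalSpace N] [ChartedSpace (EuclideanSpace ℝ (Fin (2 * m + 1))) N]
    [IsManifold (𝓡 (2 * m + 1)) ∞ N]
    (D : DoublyWarpedImmersion n₁ n₂ m M₁ M₂ N)
    (hcontact : D.S.IsContactMetric)
    (f₁ f₂ f₃ f₄ f₅₁ f₅₂ f₆ : N → ℝ)
    (hform : D.S.IsGeneralizedKappaMuSpaceForm f₁ f₂ f₃ f₄ f₅₁ f₅₂ f₆)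
    (hreal : D.IsCTotallyReal) :
    (∀ p, D.warpingTerm p ≤ D.upperBound f₁ f₄ f₅₁ f₅₂ p) ∧
    ((∀ p, D.warpingTerm p = D.upperBound f₁ f₄ f₅₁ f₅₂ p) ↔
      (D.IsMixedTotallyGeodesic ∧
        ∀ p, (n₁ : ℝ) • D.meanCurvature₁ p = (n₂ : ℝ) • D.meanCurvature₂ p)) := by
  have hg : ∀ q (u : TangentSpace (𝓡 (2 * m + 1)) q), 0 ≤ D.S.g.inner q u u := by
    intro q u
    rcases eq_or_ne u 0 with rfl | hu
    · rw [map_zero]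
    · exact (D.S.g.pos q u hu).le
  choose q hq hq0 h using fun p => D.exists_upperBound_eq p hcontact hform hreal
  refine ⟨fun p => ?_, fun heq => ⟨fun p => (hq0 p).1 ?_, fun p => ?_⟩, fun hmixed p => ?_⟩
  · rw [h]
    linarith [hq p, hg _ ((n₁ : ℝ) • D.meanCurvature₁ p - (n₂ : ℝ) • D.meanCurvature₂ p)]
  · linarith [h p, heq p, hq p,
      hg _ ((n₁ : ℝ) • D.meanCurvature₁ p - (n₂ : ℝ) • D.meanCurvature₂ p)]
  · rw [← sub_eq_zero]
    by_contra hne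
    linarith [h p, heq p, hq p, D.S.g.pos _ _ hne]
  · rw [h, (hq0 p).2 (hmixed.1 p), hmixed.2 p, sub_self, map_zero, mul_zero, add_zero, add_zero]
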